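/- **Theorem 5.1 (Type preservation).** Fix a set of operations $\mathtt{Op}$ and a signature $\Sigma$, a partial map assigning to operations typings $\mathtt{Op}:A_{\mathtt{Op}}\to B_{\mathtt{Op}}$ with $A_{\mathtt{Op}},B_{\mathtt{Op}}$ (closed) ImpEff value types. All syntax is taken up to renaming of bound variables, and bound variables are always chosen fresh. *Shared syntax.* A dirt $\Delta::=\delta\mid\emptyset\mid\{\mathtt{Op}\}\cup\Delta$ is a finite set of operations, ended by $\emptyset$ or by a dirt variable $\delta$ (order and repetition are irrelevant). $\Gamma\vdash\Delta$ means that the operations of $\Delta$ are in the domain of $\Sigma$ and its dirt variable, if any, is in $\Gamma$. For a finite set $\mathcal O$ of operations, $\Delta\cup\mathcal O$ adds $\mathcal O$ to $\Delta$. *ImpEff.* Skeletons $\tau::=\varsigma\mid\mathtt{Unit}\mid\tau\to\tau\mid\tau\Rrightarrow\tau$; value types $A,B::=\alpha\mid\mathtt{Unit}\mid A\to\underline C\mid\underline C\Rrightarrow\underline D$; computation types $\underline C,\underline D::=A\,!\,\Delta$; simple constraints $\pi::=A\le B\mid\Delta_1\le\Delta_2$; constraints $\rho::=\pi\mid\underline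 C\le\underline D$; qualified types $K::=A\mid\pi\Rightarrow K$; polytypes $S::=K\mid\forall\varsigma.S\mid\forall\alpha{:}\tau.S\mid\forall\delta.S$. Values $v::=x\mid\mathtt{unit}\mid\mathtt{fun}\,x\mapsto c\mid\{\mathtt{return}\,x\mapsto c_r,[\mathtt{Op}\,x\,k\mapsto c_{\mathtt{Op}}]_{\mathtt{Op}\in\mathcal O}\}$; computations $c::=\mathtt{return}\,v\mid\mathtt{Op}\,v\,(y.c)\mid\mathtt{do}\,x\leftarrow c_1;c_2\mid\mathtt{handle}\,c\,\mathtt{with}\,v\mid v_1\,v_2\mid\mathtt{let}\,x=v\,\mathtt{in}\,c$. A handler has at most one clause per operation. Environments $\Gamma$ are lists of entries $\varsigma$, $\alpha{:}\tau$, $\delta$, $x{:}S$, $\omega{:}\pi$. *ExEff.* Skeletons additionally have $\forall\varsigma.\tau$. Value types $T::=\alpha\mid\mathtt{Unit}\mid T\to\underline{\mathcal C}\mid\underline{\mathcal C}\Rrightarrow\underline{\mathcal C}\mid\forall\varsigma.T\mid\forall\alpha{:}\tau.T\mid\forall\delta.T\mid\pi\Rightarrow T$; computation types $\underline{\mathcal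 C}::=T\,!\,\Delta$; constraints as before but over these types. Coercions $\gamma::=\omega\mid\langle\mathtt{Unit}\rangle\mid\langle\alpha\rangle\mid\langle\Delta\rangle\mid\gamma\to\gamma\mid\gamma\Rrightarrow\gamma\mid\emptyset_\Delta\mid\{\mathtt{Op}\}\cup\gamma\mid\forall\varsigma.\gamma\mid\forall\alpha{:}\tau.\gamma\mid\forall\delta.\gamma\mid\pi\Rightarrow\gamma\mid\gamma\,!\,\gamma$. Terms are those of ImpEff with type annotations $T$ on the binders of functions, of return clauses and of continuations $y$ of operation calls, together with the values $\Lambda\varsigma.v$, $v\,\tau$, $\Lambda\alpha{:}\tau.v$, $v\,T$, $\Lambda\delta.v$, $v\,\Delta$, $\Lambda(\omega{:}\pi).v$, $v\,\gamma$ and the casts $v\triangleright\gamma$, $c\triangleright\gamma$. Environments have entries $\varsigma$, $\alpha{:}\tau$, $\delta$, $x{:}T$, $\omega{:}\pi$. *Translation.* $\lfloor\cdot\rfloor$ is the structural embedding of ImpEff skeletons, types, polytypes, constraints, environments and signatures into those of ExEff. *Well-formedness.* In both calculi $\Gamma\vdash\tau$ is well-scopedness of skeletons. $\Gamma\vdash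 A:\tau$ is given by: $\Gamma\vdash\alpha:\tau$ if $(\alpha{:}\tau)\in\Gamma$; $\mathtt{Unit}:\mathtt{Unit}$; $A\to\underline C:\tau_1\to\tau_2$ if $A:\tau_1$, $\underline C:\tau_2$; $\underline C\Rrightarrow\underline D:\tau_1\Rrightarrow\tau_2$ if $\underline C:\tau_1$, $\underline D:\tau_2$; and $A\,!\,\Delta:\tau$ if $A:\tau$ and $\Gamma\vdash\Delta$. In ExEff moreover $\forall\varsigma.T:\forall\varsigma.\tau$ if $\Gamma,\varsigma\vdash T:\tau$; $\forall\alpha{:}\tau_1.T:\tau$ if $\Gamma,\alpha{:}\tau_1\vdash T:\tau$; $\forall\delta.T:\tau$ if $\Gamma,\delta\vdash T:\tau$; $\pi\Rightarrow T:\tau$ if $\Gamma\vdash\pi$ and $\Gamma\vdash T:\tau$. A constraint between types is well formed if both sides have a common skeleton; one between dirts, if both dirts are well formed. In ImpEff, $\Gamma\vdash A:\tau\rightsquigarrow T$ and $\Gamma\vdash\pi\rightsquigarrow\pi'$ also produce, by the same recursion, the ExEff counterparts. *Entailment* $\Gamma\vdash\gamma:\rho$ (ImpEff): - $\omega:\pi$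 if $(\omega{:}\pi)\in\Gamma$; $\langle\mathtt{Unit}\rangle:\mathtt{Unit}\le\mathtt{Unit}$; $\langle\alpha\rangle:\alpha\le\alpha$ if $(\alpha{:}\tau)\in\Gamma$; $\langle\Delta\rangle:\Delta\le\Delta$ if $\Gamma\vdash\Delta$; - $\gamma_1\to\gamma_2:(A\to\underline C)\le(B\to\underline D)$ if $\gamma_1:B\le A$, $\gamma_2:\underline C\le\underline D$; $\gamma_1\Rrightarrow\gamma_2:(\underline C_1\Rrightarrow\underline D_1)\le(\underline C_2\Rrightarrow\underline D_2)$ if $\gamma_1:\underline C_2\le\underline C_1$, $\gamma_2:\underline D_1\le\underline D_2$; $\gamma_1\,!\,\gamma_2:A_1\,!\,\Delta_1\le A_2\,!\,\Delta_2$ if $\gamma_1:A_1\le A_2$, $\gamma_2:\Delta_1\le\Delta_2$; - $\emptyset_\Delta:\emptyset\le\Delta$ if $\Gamma\vdash\Delta$; $\{\mathtt{Op}\}\cup\gamma:\{\mathtt{Op}\}\cup\Delta_1\le\{\mathtt{Op}\}\cup\Delta_2$ if $\gamma:\Delta_1\le\Delta_2$ and $\mathtt{Op}\in\operatorname{dom}\Sigma$.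 ExEff coercion typing has the same rules over ExEff types ($\langle\alpha\rangle$ requiring $\Gamma\vdash\alpha:\tau$ for some $\tau$), and the congruence rules: $\forall\varsigma.\gamma:\forall\varsigma.T_1\le\forall\varsigma.T_2$ if $\Gamma,\varsigma\vdash\gamma:T_1\le T_2$, likewise for $\forall\alpha{:}\tau$ and $\forall\delta$; and $\pi\Rightarrow\gamma:(\pi\Rightarrow T_1)\le(\pi\Rightarrow T_2)$ if $\Gamma\vdash\gamma:T_1\le T_2$ and $\Gamma\vdash\pi$. *Elaboration* $\Gamma\vdash v:A\rightsquigarrow v'$ and $\Gamma\vdash c:\underline C\rightsquigarrow c'$ (ImpEff typing together with the ExEff term produced) is the least pair of relations closed under: - (Var) if $(x:\forall\bar\varsigma.\forall\overline{\alpha{:}\tau}.\forall\bar\delta.\bar\pi\Rightarrow A)\in\Gamma$, $\sigma=[\bar\tau'/\bar\varsigma,\bar B/\bar\alpha,\bar\Delta/\bar\delta]$ with $\Gamma\vdash\tau'_i$, $\Gamma\vdash B_j:\sigma(\tau_j)\rightsquigarrow T_j$, $\Gamma\vdash\Delta_k$, and $\Gamma\vdash\gamma_l:\sigma(\pi_l)$,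 then $\Gamma\vdash x:\sigma(A)\rightsquigarrow x\,\bar\tau'\,\bar T\,\bar\Delta\,\bar\gamma$; - (Cast) if $\Gamma\vdash v:A\rightsquigarrow v'$ and $\Gamma\vdash\gamma:A\le B$, then $\Gamma\vdash v:B\rightsquigarrow v'\triangleright\gamma$; likewise for computations; - (Unit) $\Gamma\vdash\mathtt{unit}:\mathtt{Unit}\rightsquigarrow\mathtt{unit}$; - (Abs) if $\Gamma,x{:}A\vdash c:\underline C\rightsquigarrow c'$ and $\Gamma\vdash A:\tau\rightsquigarrow T$, then $\Gamma\vdash\mathtt{fun}\,x\mapsto c:A\to\underline C\rightsquigarrow\mathtt{fun}\,(x{:}T)\mapsto c'$; - (Hand) if $\Gamma,x{:}A\vdash c_r:B\,!\,\Delta\rightsquigarrow c_r'$, $\Gamma\vdash A:\tau\rightsquigarrow T$, and for every $\mathtt{Op}\in\mathcal O$, $(\mathtt{Op}:A_{\mathtt{Op}}\to B_{\mathtt{Op}})\in\Sigma$ and $\Gamma,x{:}A_{\mathtt{Op}},k{:}B_{\mathtt{Op}}\to B\,!\,\Delta\vdash c_{\mathtt{Op}}:B\,!\,\Delta\rightsquigarrow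 c_{\mathtt{Op}}'$, then the handler has type $A\,!\,(\Delta\cup\mathcal O)\Rrightarrow B\,!\,\Delta$ and elaborates to $\{\mathtt{return}\,(x{:}T)\mapsto c_r',[\mathtt{Op}\,x\,k\mapsto c_{\mathtt{Op}}']_{\mathtt{Op}\in\mathcal O}\}$; - (App) if $v_1:A\to\underline C\rightsquigarrow v_1'$ and $v_2:A\rightsquigarrow v_2'$, then $v_1\,v_2:\underline C\rightsquigarrow v_1'\,v_2'$; - (Let) if $\Gamma'=\Gamma,\bar\varsigma,\overline{\alpha{:}\tau},\bar\delta$, $\Gamma'\vdash\pi_l\rightsquigarrow\pi'_l$ for each $l$, $\Gamma',\overline{\omega{:}\pi}\vdash v:A\rightsquigarrow v'$ and $\Gamma,x{:}(\forall\bar\varsigma.\forall\overline{\alpha{:}\tau}.\forall\bar\delta.\bar\pi\Rightarrow A)\vdash c:\underline C\rightsquigarrow c'$, then $\Gamma\vdash\mathtt{let}\,x=v\,\mathtt{in}\,c:\underline C\rightsquigarrow\mathtt{let}\,x=\Lambda\bar\varsigma.\Lambda\overline{\alpha{:}\tau}.\Lambda\bar\delta.\Lambda(\overline{\omega{:}\pi'}).v'\,\mathtt{in}\,c'$;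 - (Return) if $v:A\rightsquigarrow v'$, then $\mathtt{return}\,v:A\,!\,\emptyset\rightsquigarrow\mathtt{return}\,v'$; - (Op) if $(\mathtt{Op}:A_{\mathtt{Op}}\to B_{\mathtt{Op}})\in\Sigma$, $\Gamma\vdash v:A_{\mathtt{Op}}\rightsquigarrow v'$, $\Gamma,y{:}B_{\mathtt{Op}}\vdash c:A\,!\,\Delta\rightsquigarrow c'$, $\Gamma\vdash B_{\mathtt{Op}}:\tau\rightsquigarrow T$ and $\mathtt{Op}\in\Delta$, then $\mathtt{Op}\,v\,(y.c):A\,!\,\Delta\rightsquigarrow\mathtt{Op}\,v'\,(y{:}T.c')$; - (Do) if $\Gamma\vdash c_1:A\,!\,\Delta\rightsquigarrow c_1'$ and $\Gamma,x{:}A\vdash c_2:B\,!\,\Delta\rightsquigarrow c_2'$, then $\mathtt{do}\,x\leftarrow c_1;c_2:B\,!\,\Delta\rightsquigarrow\mathtt{do}\,x\leftarrow c_1';c_2'$; - (Handle) if $v:\underline C\Rrightarrow\underline D\rightsquigarrow v'$ and $c:\underline C\rightsquigarrow c'$, then $\mathtt{handle}\,c\,\mathtt{with}\,v:\underline D\rightsquigarrow\mathtt{handle}\,c'\,\mathtt{with}\,v'$.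 *ExEff typing* $\Gamma\vdash v:T$, $\Gamma\vdash c:\underline{\mathcal C}$ is the explicit, syntax-directed analogue: $x:T$ if $(x{:}T)\in\Gamma$; the rules for unit, functions (annotation well formed), handlers, application, return, do, operation calls and handling are as above over ExEff types (the annotation of a return clause is the input value type of the handler, and that of an operation call is the result type given by $\lfloor\Sigma\rfloor$; neither carries a separate well-formedness premise); $\mathtt{let}\,x=v\,\mathtt{in}\,c:\underline{\mathcal C}$ if $\Gamma\vdash v:T$ and $\Gamma,x{:}T\vdash c:\underline{\mathcal C}$; $v\triangleright\gamma:T_2$ if $v:T_1$ and $\gamma:T_1\le T_2$, and likewise for computations; $\Lambda\varsigma.v:\forall\varsigma.T$, $\Lambda\alpha{:}\tau.v:\forall\alpha{:}\tau.T$, $\Lambda\delta.v:\forall\delta.T$ and $\Lambda(\omega{:}\pi).v:\pi\Rightarrow T$ if $v:T$ in the environment extended by the bound variable, where in the last case also $\Gamma\vdash\pi$; $v\,\tau:T[\tau/\varsigma]$ if $v:\forall\varsigma.T$ and $\Gamma\vdash\tau$; $v\,T_2:T_1[T_2/\alpha]$ if $v:\forall\alpha{:}\tau.T_1$ and $\Gamma\vdash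 T_2:\tau$; $v\,\Delta:T[\Delta/\delta]$ if $v:\forall\delta.T$ and $\Gamma\vdash\Delta$; $v\,\gamma:T$ if $v:\pi\Rightarrow T$ and $\Gamma\vdash\gamma:\pi$. Operations are typed by $\lfloor\Sigma\rfloor$. **Claim.** For all $\Gamma$: 1. if $\Gamma\vdash v:A\rightsquigarrow v'$ in ImpEff, then $\lfloor\Gamma\rfloor\vdash v':\lfloor A\rfloor$ in ExEff; 2. if $\Gamma\vdash c:\underline C\rightsquigarrow c'$ in ImpEff, then $\lfloor\Gamma\rfloor\vdash c':\lfloor\underline C\rfloor$ in ExEff. -/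

import Mathlib

/-!
Syntax is represented up to renaming of bound variables by de Bruijn indices. There are five
separate index spaces: skeleton variables, type variables, dirt variables, term variables and
coercion variables. Index `0` is the innermost (most recent) binder of the given sort.
-/

universe u

/-- Extend a family indexed by de Bruijn indices by a new entry at index `0`. -/
def scons {X : Type*} (x : X) (f : ℕ → X) : ℕ → X
  | 0 => x
  | n + 1 => f n

/-- `consList [x₁, …, xₙ] f` sends `0 ↦ xₙ, …, n - 1 ↦ x₁` and `n + i ↦ f i`: the instantiation of
`n` consecutive binders, the outermost one by `x₁`. -/
def consList {X : Type*} : List X → (ℕ → X) → (ℕ → X)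
  | [], f => f
  | x :: xs, f => consList xs (scons x f)

/-- The action of an index renaming under one additional binder. -/
def liftRen (f : ℕ → ℕ) : ℕ → ℕ := scons 0 (fun n => f n + 1)

/-! ### Dirts (shared by both calculi) -/

/-- A dirt is a finite set of operations, terminated either by the empty set (`tail = none`)
or by a dirt variable. The order and the multiplicity of the operations are irrelevant. -/
@[ext] structure Dirt (Op : Type u) where
  ops : Finset Op
  tail : Option ℕ

namespace Dirt

variable {Op : Type u}

/-- `∅` -/
def empty : Dirt Op := ⟨∅, none⟩

/-- `δ` -/
def var (d : ℕ) : Dirt Op := ⟨∅, some d⟩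

def rename (f : ℕ → ℕ) (D : Dirt Op) : Dirt Op := ⟨D.ops, D.tail.map f⟩

variable [DecidableEq Op]

/-- `O ∪ Δ` -/
def union (O : Finset Op) (D : Dirt Op) : Dirt Op := ⟨O ∪ D.ops, D.tail⟩

/-- `{op} ∪ Δ` -/
def cons (op : Op) (D : Dirt Op) : Dirt Op := union {op} D

/-- Replace the dirt variable `d` by `s d`. -/
def subst (s : ℕ → Dirt Op) (D : Dirt Op) : Dirt Op :=
  match D.tail with
  | none => D
  | some d => union D.ops (s d)

end Dirt

/-! ## The implicitly typed calculus -/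

namespace ImpEff

variable {Op : Type u}

/-! ### Syntax -/

inductive Skel : Type
  | var (s : ℕ)
  | unit
  | arr (t₁ t₂ : Skel)
  | hand (t₁ t₂ : Skel)

mutual
/-- Value types `A ::= α | Unit | A → C | C ⇛ D`. -/
inductive VTy (Op : Type u) : Type u
  | var (a : ℕ)
  | unit
  | arr (A : VTy Op) (C : CTy Op)
  | hand (C D : CTy Op)
/-- Computation types `A ! Δ`. -/
inductive CTy (Op : Type u) : Type u
  | mk (A : VTy Op) (D : Dirt Op)
end

/-- Simple constraints `π ::= A₁ ≤ A₂ | Δ₁ ≤ Δ₂`. -/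
inductive SCt (Op : Type u) : Type u
  | vty (A B : VTy Op)
  | dirt (D₁ D₂ : Dirt Op)

/-- Constraints `ρ ::= π | C ≤ D`. -/
inductive Ct (Op : Type u) : Type u
  | simple (p : SCt Op)
  | cty (C D : CTy Op)

/-- Qualified types `K ::= A | π ⇒ K`. -/
inductive QTy (Op : Type u) : Type u
  | ty (A : VTy Op)
  | qual (p : SCt Op) (K : QTy Op)

/-- Polytypes `S ::= K | ∀ς. S | ∀α:τ. S | ∀δ. S`. -/
inductive PTy (Op : Type u) : Type u
  | qty (K : QTy Op)
  | allSkel (S : PTy Op)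
  | allTy (t : Skel) (S : PTy Op)
  | allDirt (S : PTy Op)

mutual
/-- Values. `lam c` is `fun x ↦ c`, and `hand c cls` is the handler with return clause
`return x ↦ c` and operation clauses `cls`. -/
inductive Val (Op : Type u) : Type u
  | var (x : ℕ)
  | unit
  | lam (c : Comp Op)
  | hand (c : Comp Op) (cls : Clauses Op)
/-- Computations. `op o v c` is `o v (y. c)`, `seq c₁ c₂` is `do x ← c₁; c₂`, `handle v c` is
`handle c with v`, and `letv v c` is `let x = v in c`. -/
inductive Comp (Op : Type u) : Type u
  | ret (v : Val Op)
  | op (o : Op) (v : Val Op) (c : Comp Op)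
  | seq (c₁ c₂ : Comp Op)
  | handle (v : Val Op) (c : Comp Op)
  | app (v₁ v₂ : Val Op)
  | letv (v : Val Op) (c : Comp Op)
/-- Operation clauses `o x k ↦ c`; in `c` the index of `k` is `0` and that of `x` is `1`. -/
inductive Clauses (Op : Type u) : Type u
  | nil
  | cons (o : Op) (c : Comp Op) (cls : Clauses Op)
end

/-- The set of operations that have a clause. -/
def Clauses.ops [DecidableEq Op] : Clauses Op → Finset Op
  | .nil => ∅
  | .cons o _ cls => insert o cls.ops

/-! ### Renaming and substitution -/

def Skel.rename (f : ℕ → ℕ) : Skel → Skel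
  | .var s => .var (f s)
  | .unit => .unit
  | .arr t₁ t₂ => .arr (t₁.rename f) (t₂.rename f)
  | .hand t₁ t₂ => .hand (t₁.rename f) (t₂.rename f)

def Skel.subst (s : ℕ → Skel) : Skel → Skel
  | .var i => s i
  | .unit => .unit
  | .arr t₁ t₂ => .arr (t₁.subst s) (t₂.subst s)
  | .hand t₁ t₂ => .hand (t₁.subst s) (t₂.subst s)

/- `ft` acts on type variables and `fd` on dirt variables. -/
mutual
def VTy.rename (ft fd : ℕ → ℕ) : VTy Op → VTy Op
  | .var a => .var (ft a)
  | .unit => .unit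
  | .arr A C => .arr (A.rename ft fd) (C.rename ft fd)
  | .hand C D => .hand (C.rename ft fd) (D.rename ft fd)
def CTy.rename (ft fd : ℕ → ℕ) : CTy Op → CTy Op
  | .mk A D => .mk (A.rename ft fd) (D.rename fd)
end

mutual
def VTy.subst [DecidableEq Op] (st : ℕ → VTy Op) (sd : ℕ → Dirt Op) : VTy Op → VTy Op
  | .var a => st a
  | .unit => .unit
  | .arr A C => .arr (A.subst st sd) (C.subst st sd)
  | .hand C D => .hand (C.subst st sd) (D.subst st sd)
def CTy.subst [DecidableEq Op] (st : ℕ → VTy Op) (sd : ℕ → Dirt Op) : CTy Op → CTy Op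
  | .mk A D => .mk (A.subst st sd) (D.subst sd)
end

def SCt.rename (ft fd : ℕ → ℕ) : SCt Op → SCt Op
  | .vty A B => .vty (A.rename ft fd) (B.rename ft fd)
  | .dirt D₁ D₂ => .dirt (D₁.rename fd) (D₂.rename fd)

def SCt.subst [DecidableEq Op] (st : ℕ → VTy Op) (sd : ℕ → Dirt Op) : SCt Op → SCt Op
  | .vty A B => .vty (A.subst st sd) (B.subst st sd)
  | .dirt D₁ D₂ => .dirt (D₁.subst sd) (D₂.subst sd)

def QTy.rename (ft fd : ℕ → ℕ) : QTy Op → QTy Op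
  | .ty A => .ty (A.rename ft fd)
  | .qual p K => .qual (p.rename ft fd) (K.rename ft fd)

/- `fs` acts on skeleton variables. -/
def PTy.rename : (fs ft fd : ℕ → ℕ) → PTy Op → PTy Op
  | _, ft, fd, .qty K => .qty (K.rename ft fd)
  | fs, ft, fd, .allSkel S => .allSkel (S.rename (liftRen fs) ft fd)
  | fs, ft, fd, .allTy t S => .allTy (t.rename fs) (S.rename fs (liftRen ft) fd)
  | fs, ft, fd, .allDirt S => .allDirt (S.rename fs ft (liftRen fd))

/-- The type scheme `∀ς₁…ς_m. ∀α₁:τ₁. … ∀α_n:τ_n. ∀δ₁…δ_q. π₁ ⇒ … ⇒ π_r ⇒ A`. -/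
def scheme (m : ℕ) (ts : List Skel) (q : ℕ) (ps : List (SCt Op)) (A : VTy Op) : PTy Op :=
  PTy.allSkel^[m] (ts.foldr .allTy (PTy.allDirt^[q] (.qty (ps.foldr .qual (.ty A)))))

/-- A monotype as a polytype. -/
def VTy.mono (A : VTy Op) : PTy Op := .qty (.ty A)

/-! ### Environments -/

/-- Typing environments. The variables in a binding refer to the part of the environment to its
left. -/
inductive Env (Op : Type u) : Type u
  | nil
  | skel (G : Env Op)
  | ty (G : Env Op) (t : Skel)
  | dirt (G : Env Op)
  | tm (G : Env Op) (S : PTy Op)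
  | co (G : Env Op) (p : SCt Op)

/-- `Γ, α₁ : τ₁, …, α_n : τ_n` -/
def Env.tys (G : Env Op) (ts : List Skel) : Env Op := ts.foldl .ty G

/-- `Γ, ω₁ : π₁, …, ω_n : π_n` -/
def Env.cos (G : Env Op) (ps : List (SCt Op)) : Env Op := ps.foldl .co G

/-- `ς ∈ Γ` -/
inductive HasSkel : Env Op → ℕ → Prop
  | here {G : Env Op} : HasSkel G.skel 0
  | skel {G : Env Op} {s : ℕ} : HasSkel G s → HasSkel G.skel (s + 1)
  | ty {G : Env Op} {s : ℕ} {t : Skel} : HasSkel G s → HasSkel (G.ty t) s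
  | dirt {G : Env Op} {s : ℕ} : HasSkel G s → HasSkel G.dirt s
  | tm {G : Env Op} {s : ℕ} {S : PTy Op} : HasSkel G s → HasSkel (G.tm S) s
  | co {G : Env Op} {s : ℕ} {p : SCt Op} : HasSkel G s → HasSkel (G.co p) s

/-- `(α : τ) ∈ Γ`, with `τ` expressed in the scope of the whole of `Γ`. -/
inductive HasTy : Env Op → ℕ → Skel → Prop
  | here {G : Env Op} {t : Skel} : HasTy (G.ty t) 0 t
  | skel {G : Env Op} {a : ℕ} {t : Skel} : HasTy G a t → HasTy G.skel a (t.rename (· + 1))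
  | ty {G : Env Op} {a : ℕ} {t t' : Skel} : HasTy G a t → HasTy (G.ty t') (a + 1) t
  | dirt {G : Env Op} {a : ℕ} {t : Skel} : HasTy G a t → HasTy G.dirt a t
  | tm {G : Env Op} {a : ℕ} {t : Skel} {S : PTy Op} : HasTy G a t → HasTy (G.tm S) a t
  | co {G : Env Op} {a : ℕ} {t : Skel} {p : SCt Op} : HasTy G a t → HasTy (G.co p) a t

/-- `δ ∈ Γ` -/
inductive HasDirt : Env Op → ℕ → Prop
  | here {G : Env Op} : HasDirt G.dirt 0
  | skel {G : Env Op} {d : ℕ} : HasDirt G d → HasDirt G.skel d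
  | ty {G : Env Op} {d : ℕ} {t : Skel} : HasDirt G d → HasDirt (G.ty t) d
  | dirt {G : Env Op} {d : ℕ} : HasDirt G d → HasDirt G.dirt (d + 1)
  | tm {G : Env Op} {d : ℕ} {S : PTy Op} : HasDirt G d → HasDirt (G.tm S) d
  | co {G : Env Op} {d : ℕ} {p : SCt Op} : HasDirt G d → HasDirt (G.co p) d

/-- `(x : S) ∈ Γ`, with `S` expressed in the scope of the whole of `Γ`. -/
inductive HasTm : Env Op → ℕ → PTy Op → Prop
  | here {G : Env Op} {S : PTy Op} : HasTm (G.tm S) 0 S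
  | skel {G : Env Op} {x : ℕ} {S : PTy Op} :
      HasTm G x S → HasTm G.skel x (S.rename (· + 1) id id)
  | ty {G : Env Op} {x : ℕ} {S : PTy Op} {t : Skel} :
      HasTm G x S → HasTm (G.ty t) x (S.rename id (· + 1) id)
  | dirt {G : Env Op} {x : ℕ} {S : PTy Op} :
      HasTm G x S → HasTm G.dirt x (S.rename id id (· + 1))
  | tm {G : Env Op} {x : ℕ} {S S' : PTy Op} : HasTm G x S → HasTm (G.tm S') (x + 1) S
  | co {G : Env Op} {x : ℕ} {S : PTy Op} {p : SCt Op} : HasTm G x S → HasTm (G.co p) x S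

/-- `(ω : π) ∈ Γ`, with `π` expressed in the scope of the whole of `Γ`. -/
inductive HasCo : Env Op → ℕ → SCt Op → Prop
  | here {G : Env Op} {p : SCt Op} : HasCo (G.co p) 0 p
  | skel {G : Env Op} {w : ℕ} {p : SCt Op} : HasCo G w p → HasCo G.skel w p
  | ty {G : Env Op} {w : ℕ} {p : SCt Op} {t : Skel} :
      HasCo G w p → HasCo (G.ty t) w (p.rename (· + 1) id)
  | dirt {G : Env Op} {w : ℕ} {p : SCt Op} : HasCo G w p → HasCo G.dirt w (p.rename id (· + 1))
  | tm {G : Env Op} {w : ℕ} {p : SCt Op} {S : PTy Op} : HasCo G w p → HasCo (G.tm S) w p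
  | co {G : Env Op} {w : ℕ} {p p' : SCt Op} : HasCo G w p → HasCo (G.co p') (w + 1) p

/-- A global signature: `Sg op = some (A, B)` means `(op : A → B) ∈ Σ`. -/
abbrev Sig (Op : Type u) : Type u := Op → Option (VTy Op × VTy Op)

end ImpEff

/-! ## The explicitly typed calculus -/

namespace ExEff

variable {Op : Type u}

/-! ### Syntax -/

inductive Skel : Type
  | var (s : ℕ)
  | unit
  | arr (t₁ t₂ : Skel)
  | hand (t₁ t₂ : Skel)
  | all (t : Skel)

mutual
/-- Value types `T ::= α | Unit | T → C | C₁ ⇛ C₂ | ∀ς. T | ∀α:τ. T | ∀δ. T | π ⇒ T`. -/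
inductive VTy (Op : Type u) : Type u
  | var (a : ℕ)
  | unit
  | arr (T : VTy Op) (C : CTy Op)
  | hand (C₁ C₂ : CTy Op)
  | allSkel (T : VTy Op)
  | allTy (t : Skel) (T : VTy Op)
  | allDirt (T : VTy Op)
  | qual (p : SCt Op) (T : VTy Op)
/-- Computation types `T ! Δ`. -/
inductive CTy (Op : Type u) : Type u
  | mk (T : VTy Op) (D : Dirt Op)
/-- Simple coercion types `π ::= T₁ ≤ T₂ | Δ₁ ≤ Δ₂`. -/
inductive SCt (Op : Type u) : Type u
  | vty (T₁ T₂ : VTy Op)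
  | dirt (D₁ D₂ : Dirt Op)
end

/-- Coercion types `ρ ::= π | C₁ ≤ C₂`. -/
inductive Ct (Op : Type u) : Type u
  | simple (p : SCt Op)
  | cty (C₁ C₂ : CTy Op)

/-- Coercions. `unit`, `tyRefl a` and `dirtRefl D` are the reflexivity coercions `⟨Unit⟩`, `⟨α⟩`
and `⟨Δ⟩`; `dirtNil D` is `∅_Δ`, `dirtOp op g` is `{op} ∪ γ`, and `comp g₁ g₂` is `γ₁ ! γ₂`. -/
inductive Co (Op : Type u) : Type u
  | var (w : ℕ)
  | unit
  | tyRefl (a : ℕ)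
  | dirtRefl (D : Dirt Op)
  | arr (g₁ g₂ : Co Op)
  | hand (g₁ g₂ : Co Op)
  | dirtNil (D : Dirt Op)
  | dirtOp (op : Op) (g : Co Op)
  | allSkel (g : Co Op)
  | allTy (t : Skel) (g : Co Op)
  | allDirt (g : Co Op)
  | qual (p : SCt Op) (g : Co Op)
  | comp (g₁ g₂ : Co Op)

mutual
/-- Values. `lamSkel`, `lamTy`, `lamDirt`, `lamCo` are the abstractions `Λς. v`, `Λα:τ. v`,
`Λδ. v`, `Λ(ω:π). v`; `appSkel`, `appTy`, `appDirt`, `appCo` the corresponding applications; and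
`cast v g` is `v ▷ γ`. -/
inductive Val (Op : Type u) : Type u
  | var (x : ℕ)
  | unit
  | lam (T : VTy Op) (c : Comp Op)
  | hand (T : VTy Op) (c : Comp Op) (cls : Clauses Op)
  | lamSkel (v : Val Op)
  | appSkel (v : Val Op) (t : Skel)
  | lamTy (t : Skel) (v : Val Op)
  | appTy (v : Val Op) (T : VTy Op)
  | lamDirt (v : Val Op)
  | appDirt (v : Val Op) (D : Dirt Op)
  | lamCo (p : SCt Op) (v : Val Op)
  | appCo (v : Val Op) (g : Co Op)
  | cast (v : Val Op) (g : Co Op)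
/-- Computations. `op o v T c` is `o v (y : T. c)`. -/
inductive Comp (Op : Type u) : Type u
  | ret (v : Val Op)
  | op (o : Op) (v : Val Op) (T : VTy Op) (c : Comp Op)
  | seq (c₁ c₂ : Comp Op)
  | handle (v : Val Op) (c : Comp Op)
  | app (v₁ v₂ : Val Op)
  | letv (v : Val Op) (c : Comp Op)
  | cast (c : Comp Op) (g : Co Op)
/-- Operation clauses `o x k ↦ c`; in `c` the index of `k` is `0` and that of `x` is `1`. -/
inductive Clauses (Op : Type u) : Type u
  | nil
  | cons (o : Op) (c : Comp Op) (cls : Clauses Op)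
end

/-- The set of operations that have a clause. -/
def Clauses.ops [DecidableEq Op] : Clauses Op → Finset Op
  | .nil => ∅
  | .cons o _ cls => insert o cls.ops

/-! ### Renaming and substitution -/

def Skel.rename : (ℕ → ℕ) → Skel → Skel
  | f, .var s => .var (f s)
  | _, .unit => .unit
  | f, .arr t₁ t₂ => .arr (t₁.rename f) (t₂.rename f)
  | f, .hand t₁ t₂ => .hand (t₁.rename f) (t₂.rename f)
  | f, .all t => .all (t.rename (liftRen f))

def Skel.subst : (ℕ → Skel) → Skel → Skel
  | s, .var i => s i
  | _, .unit => .unit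
  | s, .arr t₁ t₂ => .arr (t₁.subst s) (t₂.subst s)
  | s, .hand t₁ t₂ => .hand (t₁.subst s) (t₂.subst s)
  | s, .all t => .all (t.subst (scons (.var 0) (fun n => (s n).rename (· + 1))))

/- `fs`, `ft`, `fd` act on skeleton, type and dirt variables. -/
mutual
def VTy.rename : (fs ft fd : ℕ → ℕ) → VTy Op → VTy Op
  | _, ft, _, .var a => .var (ft a)
  | _, _, _, .unit => .unit
  | fs, ft, fd, .arr T C => .arr (T.rename fs ft fd) (C.rename fs ft fd)
  | fs, ft, fd, .hand C₁ C₂ => .hand (C₁.rename fs ft fd) (C₂.rename fs ft fd)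
  | fs, ft, fd, .allSkel T => .allSkel (T.rename (liftRen fs) ft fd)
  | fs, ft, fd, .allTy t T => .allTy (t.rename fs) (T.rename fs (liftRen ft) fd)
  | fs, ft, fd, .allDirt T => .allDirt (T.rename fs ft (liftRen fd))
  | fs, ft, fd, .qual p T => .qual (p.rename fs ft fd) (T.rename fs ft fd)
def CTy.rename : (fs ft fd : ℕ → ℕ) → CTy Op → CTy Op
  | fs, ft, fd, .mk T D => .mk (T.rename fs ft fd) (D.rename fd)
def SCt.rename : (fs ft fd : ℕ → ℕ) → SCt Op → SCt Op
  | fs, ft, fd, .vty T₁ T₂ => .vty (T₁.rename fs ft fd) (T₂.rename fs ft fd)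
  | _, _, fd, .dirt D₁ D₂ => .dirt (D₁.rename fd) (D₂.rename fd)
end

/- Capture-avoiding simultaneous substitution of skeletons, types and dirts. -/
mutual
def VTy.subst [DecidableEq Op] :
    (ss : ℕ → Skel) → (st : ℕ → VTy Op) → (sd : ℕ → Dirt Op) → VTy Op → VTy Op
  | _, st, _, .var a => st a
  | _, _, _, .unit => .unit
  | ss, st, sd, .arr T C => .arr (T.subst ss st sd) (C.subst ss st sd)
  | ss, st, sd, .hand C₁ C₂ => .hand (C₁.subst ss st sd) (C₂.subst ss st sd)
  | ss, st, sd, .allSkel T =>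
      .allSkel (T.subst (scons (.var 0) (fun n => (ss n).rename (· + 1)))
        (fun n => (st n).rename (· + 1) id id) sd)
  | ss, st, sd, .allTy t T =>
      .allTy (t.subst ss)
        (T.subst ss (scons (.var 0) (fun n => (st n).rename id (· + 1) id)) sd)
  | ss, st, sd, .allDirt T =>
      .allDirt (T.subst ss (fun n => (st n).rename id id (· + 1))
        (scons (.var 0) (fun n => (sd n).rename (· + 1))))
  | ss, st, sd, .qual p T => .qual (p.subst ss st sd) (T.subst ss st sd)
def CTy.subst [DecidableEq Op] :
    (ss : ℕ → Skel) → (st : ℕ → VTy Op) → (sd : ℕ → Dirt Op) → CTy Op → CTy Op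
  | ss, st, sd, .mk T D => .mk (T.subst ss st sd) (D.subst sd)
def SCt.subst [DecidableEq Op] :
    (ss : ℕ → Skel) → (st : ℕ → VTy Op) → (sd : ℕ → Dirt Op) → SCt Op → SCt Op
  | ss, st, sd, .vty T₁ T₂ => .vty (T₁.subst ss st sd) (T₂.subst ss st sd)
  | _, _, sd, .dirt D₁ D₂ => .dirt (D₁.subst sd) (D₂.subst sd)
end

/-- `T[τ/ς]` for the innermost skeleton variable `ς`. -/
def VTy.instSkel [DecidableEq Op] (T : VTy Op) (t : Skel) : VTy Op :=
  T.subst (scons t .var) .var .var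

/-- `T[T'/α]` for the innermost type variable `α`. -/
def VTy.instTy [DecidableEq Op] (T T' : VTy Op) : VTy Op :=
  T.subst .var (scons T' .var) .var

/-- `T[Δ/δ]` for the innermost dirt variable `δ`. -/
def VTy.instDirt [DecidableEq Op] (T : VTy Op) (D : Dirt Op) : VTy Op :=
  T.subst .var .var (scons D .var)

/-! ### Environments -/

/-- Typing environments. The variables in a binding refer to the part of the environment to its
left. -/
inductive Env (Op : Type u) : Type u
  | nil
  | skel (G : Env Op)
  | ty (G : Env Op) (t : Skel)
  | dirt (G : Env Op)
  | tm (G : Env Op) (T : VTy Op)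
  | co (G : Env Op) (p : SCt Op)

/-- `ς ∈ Γ` -/
inductive HasSkel : Env Op → ℕ → Prop
  | here {G : Env Op} : HasSkel G.skel 0
  | skel {G : Env Op} {s : ℕ} : HasSkel G s → HasSkel G.skel (s + 1)
  | ty {G : Env Op} {s : ℕ} {t : Skel} : HasSkel G s → HasSkel (G.ty t) s
  | dirt {G : Env Op} {s : ℕ} : HasSkel G s → HasSkel G.dirt s
  | tm {G : Env Op} {s : ℕ} {T : VTy Op} : HasSkel G s → HasSkel (G.tm T) s
  | co {G : Env Op} {s : ℕ} {p : SCt Op} : HasSkel G s → HasSkel (G.co p) s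

/-- `(α : τ) ∈ Γ`, with `τ` expressed in the scope of the whole of `Γ`. -/
inductive HasTy : Env Op → ℕ → Skel → Prop
  | here {G : Env Op} {t : Skel} : HasTy (G.ty t) 0 t
  | skel {G : Env Op} {a : ℕ} {t : Skel} : HasTy G a t → HasTy G.skel a (t.rename (· + 1))
  | ty {G : Env Op} {a : ℕ} {t t' : Skel} : HasTy G a t → HasTy (G.ty t') (a + 1) t
  | dirt {G : Env Op} {a : ℕ} {t : Skel} : HasTy G a t → HasTy G.dirt a t
  | tm {G : Env Op} {a : ℕ} {t : Skel} {T : VTy Op} : HasTy G a t → HasTy (G.tm T) a t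
  | co {G : Env Op} {a : ℕ} {t : Skel} {p : SCt Op} : HasTy G a t → HasTy (G.co p) a t

/-- `δ ∈ Γ` -/
inductive HasDirt : Env Op → ℕ → Prop
  | here {G : Env Op} : HasDirt G.dirt 0
  | skel {G : Env Op} {d : ℕ} : HasDirt G d → HasDirt G.skel d
  | ty {G : Env Op} {d : ℕ} {t : Skel} : HasDirt G d → HasDirt (G.ty t) d
  | dirt {G : Env Op} {d : ℕ} : HasDirt G d → HasDirt G.dirt (d + 1)
  | tm {G : Env Op} {d : ℕ} {T : VTy Op} : HasDirt G d → HasDirt (G.tm T) d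
  | co {G : Env Op} {d : ℕ} {p : SCt Op} : HasDirt G d → HasDirt (G.co p) d

/-- `(x : T) ∈ Γ`, with `T` expressed in the scope of the whole of `Γ`. -/
inductive HasTm : Env Op → ℕ → VTy Op → Prop
  | here {G : Env Op} {T : VTy Op} : HasTm (G.tm T) 0 T
  | skel {G : Env Op} {x : ℕ} {T : VTy Op} :
      HasTm G x T → HasTm G.skel x (T.rename (· + 1) id id)
  | ty {G : Env Op} {x : ℕ} {T : VTy Op} {t : Skel} :
      HasTm G x T → HasTm (G.ty t) x (T.rename id (· + 1) id)
  | dirt {G : Env Op} {x : ℕ} {T : VTy Op} :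
      HasTm G x T → HasTm G.dirt x (T.rename id id (· + 1))
  | tm {G : Env Op} {x : ℕ} {T T' : VTy Op} : HasTm G x T → HasTm (G.tm T') (x + 1) T
  | co {G : Env Op} {x : ℕ} {T : VTy Op} {p : SCt Op} : HasTm G x T → HasTm (G.co p) x T

/-- `(ω : π) ∈ Γ`, with `π` expressed in the scope of the whole of `Γ`. -/
inductive HasCo : Env Op → ℕ → SCt Op → Prop
  | here {G : Env Op} {p : SCt Op} : HasCo (G.co p) 0 p
  | skel {G : Env Op} {w : ℕ} {p : SCt Op} :
      HasCo G w p → HasCo G.skel w (p.rename (· + 1) id id)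
  | ty {G : Env Op} {w : ℕ} {p : SCt Op} {t : Skel} :
      HasCo G w p → HasCo (G.ty t) w (p.rename id (· + 1) id)
  | dirt {G : Env Op} {w : ℕ} {p : SCt Op} :
      HasCo G w p → HasCo G.dirt w (p.rename id id (· + 1))
  | tm {G : Env Op} {w : ℕ} {p : SCt Op} {T : VTy Op} : HasCo G w p → HasCo (G.tm T) w p
  | co {G : Env Op} {w : ℕ} {p p' : SCt Op} : HasCo G w p → HasCo (G.co p') (w + 1) p

/-- A global signature: `Sg op = some (T₁, T₂)` means `(op : T₁ → T₂) ∈ Σ`. -/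
abbrev Sig (Op : Type u) : Type u := Op → Option (VTy Op × VTy Op)

/-! ### Well-formedness -/

/-- `Γ ⊢ τ` -/
inductive WfSkel : Env Op → Skel → Prop
  | var {G : Env Op} {s : ℕ} : HasSkel G s → WfSkel G (.var s)
  | unit {G : Env Op} : WfSkel G .unit
  | arr {G : Env Op} {t₁ t₂ : Skel} : WfSkel G t₁ → WfSkel G t₂ → WfSkel G (.arr t₁ t₂)
  | hand {G : Env Op} {t₁ t₂ : Skel} : WfSkel G t₁ → WfSkel G t₂ → WfSkel G (.hand t₁ t₂)
  | all {G : Env Op} {t : Skel} : WfSkel G.skel t → WfSkel G (.all t)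

variable [DecidableEq Op]

/-- `Γ ⊢ Δ` -/
inductive WfDirt (Sg : Sig Op) : Env Op → Dirt Op → Prop
  | empty {G : Env Op} : WfDirt Sg G .empty
  | var {G : Env Op} {d : ℕ} : HasDirt G d → WfDirt Sg G (.var d)
  | cons {G : Env Op} {op : Op} {T₁ T₂ : VTy Op} {D : Dirt Op} :
      Sg op = some (T₁, T₂) → WfDirt Sg G D → WfDirt Sg G (.cons op D)

mutual
/-- `Γ ⊢ T : τ` -/
inductive WfVTy (Sg : Sig Op) : Env Op → VTy Op → Skel → Prop
  | var {G : Env Op} {a : ℕ} {t : Skel} : HasTy G a t → WfVTy Sg G (.var a) t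
  | arr {G : Env Op} {T : VTy Op} {C : CTy Op} {t₁ t₂ : Skel} :
      WfVTy Sg G T t₁ → WfCTy Sg G C t₂ → WfVTy Sg G (.arr T C) (.arr t₁ t₂)
  | hand {G : Env Op} {C₁ C₂ : CTy Op} {t₁ t₂ : Skel} :
      WfCTy Sg G C₁ t₁ → WfCTy Sg G C₂ t₂ → WfVTy Sg G (.hand C₁ C₂) (.hand t₁ t₂)
  | unit {G : Env Op} : WfVTy Sg G .unit .unit
  | qual {G : Env Op} {p : SCt Op} {T : VTy Op} {t : Skel} :
      WfSCt Sg G p → WfVTy Sg G T t → WfVTy Sg G (.qual p T) t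
  | allSkel {G : Env Op} {T : VTy Op} {t : Skel} :
      WfVTy Sg G.skel T t → WfVTy Sg G (.allSkel T) (.all t)
  | allTy {G : Env Op} {T : VTy Op} {t₁ t₂ : Skel} :
      WfVTy Sg (G.ty t₁) T t₂ → WfVTy Sg G (.allTy t₁ T) t₂
  | allDirt {G : Env Op} {T : VTy Op} {t : Skel} :
      WfVTy Sg G.dirt T t → WfVTy Sg G (.allDirt T) t
/-- `Γ ⊢ C : τ` -/
inductive WfCTy (Sg : Sig Op) : Env Op → CTy Op → Skel → Prop
  | mk {G : Env Op} {T : VTy Op} {D : Dirt Op} {t : Skel} :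
      WfVTy Sg G T t → WfDirt Sg G D → WfCTy Sg G (.mk T D) t
/-- `Γ ⊢ π` -/
inductive WfSCt (Sg : Sig Op) : Env Op → SCt Op → Prop
  | vty {G : Env Op} {T₁ T₂ : VTy Op} {t : Skel} :
      WfVTy Sg G T₁ t → WfVTy Sg G T₂ t → WfSCt Sg G (.vty T₁ T₂)
  | dirt {G : Env Op} {D₁ D₂ : Dirt Op} :
      WfDirt Sg G D₁ → WfDirt Sg G D₂ → WfSCt Sg G (.dirt D₁ D₂)
end

/-! ### Coercion typing -/

/-- `Γ ⊢ γ : ρ` -/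
inductive CoTy (Sg : Sig Op) : Env Op → Co Op → Ct Op → Prop
  | var {G : Env Op} {w : ℕ} {p : SCt Op} : HasCo G w p → CoTy Sg G (.var w) (.simple p)
  | tyRefl {G : Env Op} {a : ℕ} {t : Skel} :
      WfVTy Sg G (.var a) t → CoTy Sg G (.tyRefl a) (.simple (.vty (.var a) (.var a)))
  | dirtRefl {G : Env Op} {D : Dirt Op} :
      WfDirt Sg G D → CoTy Sg G (.dirtRefl D) (.simple (.dirt D D))
  | unit {G : Env Op} : CoTy Sg G .unit (.simple (.vty .unit .unit))
  | arr {G : Env Op} {g₁ g₂ : Co Op} {T₁ T₂ : VTy Op} {C₁ C₂ : CTy Op} :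
      CoTy Sg G g₁ (.simple (.vty T₂ T₁)) → CoTy Sg G g₂ (.cty C₁ C₂) →
      CoTy Sg G (.arr g₁ g₂) (.simple (.vty (.arr T₁ C₁) (.arr T₂ C₂)))
  | hand {G : Env Op} {g₁ g₂ : Co Op} {C₁ C₂ C₃ C₄ : CTy Op} :
      CoTy Sg G g₁ (.cty C₃ C₁) → CoTy Sg G g₂ (.cty C₂ C₄) →
      CoTy Sg G (.hand g₁ g₂) (.simple (.vty (.hand C₁ C₂) (.hand C₃ C₄)))
  | allSkel {G : Env Op} {g : Co Op} {T₁ T₂ : VTy Op} :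
      CoTy Sg G.skel g (.simple (.vty T₁ T₂)) →
      CoTy Sg G (.allSkel g) (.simple (.vty (.allSkel T₁) (.allSkel T₂)))
  | allTy {G : Env Op} {t : Skel} {g : Co Op} {T₁ T₂ : VTy Op} :
      CoTy Sg (G.ty t) g (.simple (.vty T₁ T₂)) →
      CoTy Sg G (.allTy t g) (.simple (.vty (.allTy t T₁) (.allTy t T₂)))
  | allDirt {G : Env Op} {g : Co Op} {T₁ T₂ : VTy Op} :
      CoTy Sg G.dirt g (.simple (.vty T₁ T₂)) →
      CoTy Sg G (.allDirt g) (.simple (.vty (.allDirt T₁) (.allDirt T₂)))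
  | qual {G : Env Op} {p : SCt Op} {g : Co Op} {T₁ T₂ : VTy Op} :
      CoTy Sg G g (.simple (.vty T₁ T₂)) → WfSCt Sg G p →
      CoTy Sg G (.qual p g) (.simple (.vty (.qual p T₁) (.qual p T₂)))
  | dirtNil {G : Env Op} {D : Dirt Op} :
      WfDirt Sg G D → CoTy Sg G (.dirtNil D) (.simple (.dirt .empty D))
  | comp {G : Env Op} {g₁ g₂ : Co Op} {T₁ T₂ : VTy Op} {D₁ D₂ : Dirt Op} :
      CoTy Sg G g₁ (.simple (.vty T₁ T₂)) → CoTy Sg G g₂ (.simple (.dirt D₁ D₂)) →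
      CoTy Sg G (.comp g₁ g₂) (.cty (.mk T₁ D₁) (.mk T₂ D₂))
  | dirtOp {G : Env Op} {op : Op} {g : Co Op} {D₁ D₂ : Dirt Op} {T₁ T₂ : VTy Op} :
      CoTy Sg G g (.simple (.dirt D₁ D₂)) → Sg op = some (T₁, T₂) →
      CoTy Sg G (.dirtOp op g) (.simple (.dirt (.cons op D₁) (.cons op D₂)))

/-! ### Term typing -/

mutual
/-- `Γ ⊢ v : T` -/
inductive ValTy (Sg : Sig Op) : Env Op → Val Op → VTy Op → Prop
  | var {G : Env Op} {x : ℕ} {T : VTy Op} : HasTm G x T → ValTy Sg G (.var x) T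
  | unit {G : Env Op} : ValTy Sg G .unit .unit
  | lam {G : Env Op} {T : VTy Op} {c : Comp Op} {C : CTy Op} {t : Skel} :
      CompTy Sg (G.tm T) c C → WfVTy Sg G T t → ValTy Sg G (.lam T c) (.arr T C)
  | cast {G : Env Op} {v : Val Op} {g : Co Op} {T₁ T₂ : VTy Op} :
      ValTy Sg G v T₁ → CoTy Sg G g (.simple (.vty T₁ T₂)) → ValTy Sg G (.cast v g) T₂
  | lamSkel {G : Env Op} {v : Val Op} {T : VTy Op} :
      ValTy Sg G.skel v T → ValTy Sg G (.lamSkel v) (.allSkel T)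
  | lamTy {G : Env Op} {t : Skel} {v : Val Op} {T : VTy Op} :
      ValTy Sg (G.ty t) v T → ValTy Sg G (.lamTy t v) (.allTy t T)
  | lamDirt {G : Env Op} {v : Val Op} {T : VTy Op} :
      ValTy Sg G.dirt v T → ValTy Sg G (.lamDirt v) (.allDirt T)
  | lamCo {G : Env Op} {p : SCt Op} {v : Val Op} {T : VTy Op} :
      ValTy Sg (G.co p) v T → WfSCt Sg G p → ValTy Sg G (.lamCo p v) (.qual p T)
  | appCo {G : Env Op} {v : Val Op} {g : Co Op} {p : SCt Op} {T : VTy Op} :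
      ValTy Sg G v (.qual p T) → CoTy Sg G g (.simple p) → ValTy Sg G (.appCo v g) T
  | hand {G : Env Op} {Tx T : VTy Op} {D : Dirt Op} {c : Comp Op} {cls : Clauses Op} :
      CompTy Sg (G.tm Tx) c (.mk T D) → ClausesTy Sg G T D cls →
      ValTy Sg G (.hand Tx c cls) (.hand (.mk Tx (.union cls.ops D)) (.mk T D))
  | appSkel {G : Env Op} {v : Val Op} {T : VTy Op} {t : Skel} :
      ValTy Sg G v (.allSkel T) → WfSkel G t → ValTy Sg G (.appSkel v t) (T.instSkel t)
  | appTy {G : Env Op} {v : Val Op} {t : Skel} {T₁ T₂ : VTy Op} :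
      ValTy Sg G v (.allTy t T₁) → WfVTy Sg G T₂ t → ValTy Sg G (.appTy v T₂) (T₁.instTy T₂)
  | appDirt {G : Env Op} {v : Val Op} {T : VTy Op} {D : Dirt Op} :
      ValTy Sg G v (.allDirt T) → WfDirt Sg G D → ValTy Sg G (.appDirt v D) (T.instDirt D)
/-- `Γ ⊢ c : C` -/
inductive CompTy (Sg : Sig Op) : Env Op → Comp Op → CTy Op → Prop
  | app {G : Env Op} {v₁ v₂ : Val Op} {T : VTy Op} {C : CTy Op} :
      ValTy Sg G v₁ (.arr T C) → ValTy Sg G v₂ T → CompTy Sg G (.app v₁ v₂) C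
  | letv {G : Env Op} {v : Val Op} {c : Comp Op} {T : VTy Op} {C : CTy Op} :
      ValTy Sg G v T → CompTy Sg (G.tm T) c C → CompTy Sg G (.letv v c) C
  | ret {G : Env Op} {v : Val Op} {T : VTy Op} :
      ValTy Sg G v T → CompTy Sg G (.ret v) (.mk T .empty)
  | seq {G : Env Op} {c₁ c₂ : Comp Op} {T₁ T₂ : VTy Op} {D : Dirt Op} :
      CompTy Sg G c₁ (.mk T₁ D) → CompTy Sg (G.tm T₁) c₂ (.mk T₂ D) →
      CompTy Sg G (.seq c₁ c₂) (.mk T₂ D)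
  | op {G : Env Op} {o : Op} {v : Val Op} {c : Comp Op} {T₁ T₂ T : VTy Op} {D : Dirt Op} :
      Sg o = some (T₁, T₂) → ValTy Sg G v T₁ → CompTy Sg (G.tm T₂) c (.mk T D) → o ∈ D.ops →
      CompTy Sg G (.op o v T₂ c) (.mk T D)
  | handle {G : Env Op} {v : Val Op} {c : Comp Op} {C₁ C₂ : CTy Op} :
      ValTy Sg G v (.hand C₁ C₂) → CompTy Sg G c C₁ → CompTy Sg G (.handle v c) C₂
  | cast {G : Env Op} {c : Comp Op} {g : Co Op} {C₁ C₂ : CTy Op} :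
      CompTy Sg G c C₁ → CoTy Sg G g (.cty C₁ C₂) → CompTy Sg G (.cast c g) C₂
/-- All operation clauses of a handler with result type `T ! Δ` are well typed; no operation has
two clauses. -/
inductive ClausesTy (Sg : Sig Op) : Env Op → VTy Op → Dirt Op → Clauses Op → Prop
  | nil {G : Env Op} {T : VTy Op} {D : Dirt Op} : ClausesTy Sg G T D .nil
  | cons {G : Env Op} {T T₁ T₂ : VTy Op} {D : Dirt Op} {o : Op} {c : Comp Op}
      {cls : Clauses Op} :
      Sg o = some (T₁, T₂) → CompTy Sg ((G.tm T₁).tm (.arr T₂ (.mk T D))) c (.mk T D) →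
      o ∉ cls.ops → ClausesTy Sg G T D cls → ClausesTy Sg G T D (.cons o c cls)
end

/-- `Λς₁…ς_m. Λα₁:τ₁. … Λα_n:τ_n. Λδ₁…δ_q. Λ(ω₁:π₁). … Λ(ω_r:π_r). v` -/
def Val.gen (m : ℕ) (ts : List Skel) (q : ℕ) (ps : List (SCt Op)) (v : Val Op) : Val Op :=
  Val.lamSkel^[m] (ts.foldr .lamTy (Val.lamDirt^[q] (ps.foldr .lamCo v)))

/-- `v τ₁ … τ_m T₁ … T_n Δ₁ … Δ_q γ₁ … γ_r` -/
def Val.inst (v : Val Op) (ts : List Skel) (Ts : List (VTy Op)) (Ds : List (Dirt Op))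
    (gs : List (Co Op)) : Val Op :=
  gs.foldl .appCo (Ds.foldl .appDirt (Ts.foldl .appTy (ts.foldl .appSkel v)))

end ExEff

/-! ## Typing and elaboration of the implicitly typed calculus -/

namespace ImpEff

variable {Op : Type u}

/-! ### Translation of types, constraints, environments and signatures -/

def Skel.toEx : Skel → ExEff.Skel
  | .var s => .var s
  | .unit => .unit
  | .arr t₁ t₂ => .arr t₁.toEx t₂.toEx
  | .hand t₁ t₂ => .hand t₁.toEx t₂.toEx

mutual
def VTy.toEx : VTy Op → ExEff.VTy Op
  | .var a => .var a
  | .unit => .unit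
  | .arr A C => .arr A.toEx C.toEx
  | .hand C D => .hand C.toEx D.toEx
def CTy.toEx : CTy Op → ExEff.CTy Op
  | .mk A D => .mk A.toEx D
end

def SCt.toEx : SCt Op → ExEff.SCt Op
  | .vty A B => .vty A.toEx B.toEx
  | .dirt D₁ D₂ => .dirt D₁ D₂

def QTy.toEx : QTy Op → ExEff.VTy Op
  | .ty A => A.toEx
  | .qual p K => .qual p.toEx K.toEx

def PTy.toEx : PTy Op → ExEff.VTy Op
  | .qty K => K.toEx
  | .allSkel S => .allSkel S.toEx
  | .allTy t S => .allTy t.toEx S.toEx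
  | .allDirt S => .allDirt S.toEx

def Env.toEx : Env Op → ExEff.Env Op
  | .nil => .nil
  | .skel G => .skel G.toEx
  | .ty G t => .ty G.toEx t.toEx
  | .dirt G => .dirt G.toEx
  | .tm G S => .tm G.toEx S.toEx
  | .co G p => .co G.toEx p.toEx

def Sig.toEx (Sg : Sig Op) : ExEff.Sig Op :=
  fun op => (Sg op).map fun AB => (AB.1.toEx, AB.2.toEx)

/-! ### Well-formedness -/

/-- `Γ ⊢ τ` -/
inductive WfSkel : Env Op → Skel → Prop
  | var {G : Env Op} {s : ℕ} : HasSkel G s → WfSkel G (.var s)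
  | unit {G : Env Op} : WfSkel G .unit
  | arr {G : Env Op} {t₁ t₂ : Skel} : WfSkel G t₁ → WfSkel G t₂ → WfSkel G (.arr t₁ t₂)
  | hand {G : Env Op} {t₁ t₂ : Skel} : WfSkel G t₁ → WfSkel G t₂ → WfSkel G (.hand t₁ t₂)

variable [DecidableEq Op]

/-- `Γ ⊢ Δ` -/
inductive WfDirt (Sg : Sig Op) : Env Op → Dirt Op → Prop
  | empty {G : Env Op} : WfDirt Sg G .empty
  | var {G : Env Op} {d : ℕ} : HasDirt G d → WfDirt Sg G (.var d)
  | cons {G : Env Op} {op : Op} {A B : VTy Op} {D : Dirt Op} :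
      Sg op = some (A, B) → WfDirt Sg G D → WfDirt Sg G (.cons op D)

mutual
/-- `Γ ⊢ A : τ ⇝ T` -/
inductive WfVTy (Sg : Sig Op) : Env Op → VTy Op → Skel → ExEff.VTy Op → Prop
  | var {G : Env Op} {a : ℕ} {t : Skel} : HasTy G a t → WfVTy Sg G (.var a) t (.var a)
  | arr {G : Env Op} {A : VTy Op} {C : CTy Op} {t₁ t₂ : Skel} {T : ExEff.VTy Op}
      {C' : ExEff.CTy Op} :
      WfVTy Sg G A t₁ T → WfCTy Sg G C t₂ C' →
      WfVTy Sg G (.arr A C) (.arr t₁ t₂) (.arr T C')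
  | hand {G : Env Op} {C D : CTy Op} {t₁ t₂ : Skel} {C' D' : ExEff.CTy Op} :
      WfCTy Sg G C t₁ C' → WfCTy Sg G D t₂ D' →
      WfVTy Sg G (.hand C D) (.hand t₁ t₂) (.hand C' D')
  | unit {G : Env Op} : WfVTy Sg G .unit .unit .unit
/-- `Γ ⊢ C : τ ⇝ C'` -/
inductive WfCTy (Sg : Sig Op) : Env Op → CTy Op → Skel → ExEff.CTy Op → Prop
  | mk {G : Env Op} {A : VTy Op} {D : Dirt Op} {t : Skel} {T : ExEff.VTy Op} :
      WfVTy Sg G A t T → WfDirt Sg G D → WfCTy Sg G (.mk A D) t (.mk T D)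
end

/-- `Γ ⊢ π ⇝ π'` -/
inductive WfSCt (Sg : Sig Op) : Env Op → SCt Op → ExEff.SCt Op → Prop
  | vty {G : Env Op} {A B : VTy Op} {t : Skel} {T₁ T₂ : ExEff.VTy Op} :
      WfVTy Sg G A t T₁ → WfVTy Sg G B t T₂ → WfSCt Sg G (.vty A B) (.vty T₁ T₂)
  | dirt {G : Env Op} {D₁ D₂ : Dirt Op} :
      WfDirt Sg G D₁ → WfDirt Sg G D₂ → WfSCt Sg G (.dirt D₁ D₂) (.dirt D₁ D₂)

/-- `Γ ⊢ B₁ : τ₁ ⇝ T₁, …, Γ ⊢ B_n : τ_n ⇝ T_n` -/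
inductive WfVTys (Sg : Sig Op) (G : Env Op) :
    List (VTy Op) → List Skel → List (ExEff.VTy Op) → Prop
  | nil : WfVTys Sg G [] [] []
  | cons {B : VTy Op} {t : Skel} {T : ExEff.VTy Op} {Bs : List (VTy Op)} {ts : List Skel}
      {Ts : List (ExEff.VTy Op)} :
      WfVTy Sg G B t T → WfVTys Sg G Bs ts Ts → WfVTys Sg G (B :: Bs) (t :: ts) (T :: Ts)

/-! ### Constraint entailment -/

/-- `Γ ⊢ γ : ρ`, where `γ` is the explicit witness of the entailment of `ρ`. -/
inductive Entails (Sg : Sig Op) : Env Op → ExEff.Co Op → Ct Op → Prop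
  | var {G : Env Op} {w : ℕ} {p : SCt Op} : HasCo G w p → Entails Sg G (.var w) (.simple p)
  | unit {G : Env Op} : Entails Sg G .unit (.simple (.vty .unit .unit))
  | tyRefl {G : Env Op} {a : ℕ} {t : Skel} :
      HasTy G a t → Entails Sg G (.tyRefl a) (.simple (.vty (.var a) (.var a)))
  | dirtRefl {G : Env Op} {D : Dirt Op} :
      WfDirt Sg G D → Entails Sg G (.dirtRefl D) (.simple (.dirt D D))
  | arr {G : Env Op} {g₁ g₂ : ExEff.Co Op} {A B : VTy Op} {C D : CTy Op} :
      Entails Sg G g₁ (.simple (.vty B A)) → Entails Sg G g₂ (.cty C D) →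
      Entails Sg G (.arr g₁ g₂) (.simple (.vty (.arr A C) (.arr B D)))
  | hand {G : Env Op} {g₁ g₂ : ExEff.Co Op} {C₁ C₂ D₁ D₂ : CTy Op} :
      Entails Sg G g₁ (.cty C₂ C₁) → Entails Sg G g₂ (.cty D₁ D₂) →
      Entails Sg G (.hand g₁ g₂) (.simple (.vty (.hand C₁ D₁) (.hand C₂ D₂)))
  | comp {G : Env Op} {g₁ g₂ : ExEff.Co Op} {A₁ A₂ : VTy Op} {D₁ D₂ : Dirt Op} :
      Entails Sg G g₁ (.simple (.vty A₁ A₂)) → Entails Sg G g₂ (.simple (.dirt D₁ D₂)) →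
      Entails Sg G (.comp g₁ g₂) (.cty (.mk A₁ D₁) (.mk A₂ D₂))
  | dirtNil {G : Env Op} {D : Dirt Op} :
      WfDirt Sg G D → Entails Sg G (.dirtNil D) (.simple (.dirt .empty D))
  | dirtOp {G : Env Op} {op : Op} {g : ExEff.Co Op} {D₁ D₂ : Dirt Op} {A B : VTy Op} :
      Entails Sg G g (.simple (.dirt D₁ D₂)) → Sg op = some (A, B) →
      Entails Sg G (.dirtOp op g) (.simple (.dirt (.cons op D₁) (.cons op D₂)))

/-! ### Typing with elaboration -/

mutual
/-- `Γ ⊢ v : A ⇝ v'` -/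
inductive ElabVal (Sg : Sig Op) : Env Op → Val Op → VTy Op → ExEff.Val Op → Prop
  /- `ts'`, `Bs`, `Ds` are the skeletons, types and dirts by which the substitution instantiates
  the quantified variables of the type scheme of `x`. -/
  | var {G : Env Op} {x m q : ℕ} {ts ts' : List Skel} {ps : List (SCt Op)} {A : VTy Op}
      {Bs : List (VTy Op)} {Ds : List (Dirt Op)} {Ts : List (ExEff.VTy Op)}
      {gs : List (ExEff.Co Op)} :
      HasTm G x (scheme m ts q ps A) →
      ts'.length = m → (∀ t ∈ ts', WfSkel G t) →
      WfVTys Sg G Bs (ts.map (Skel.subst (consList ts' .var))) Ts →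
      Ds.length = q → (∀ D ∈ Ds, WfDirt Sg G D) →
      List.Forall₂
        (fun g p => Entails Sg G g (.simple (p.subst (consList Bs .var) (consList Ds .var))))
        gs ps →
      ElabVal Sg G (.var x) (A.subst (consList Bs .var) (consList Ds .var))
        ((ExEff.Val.var x).inst (ts'.map Skel.toEx) Ts Ds gs)
  | cast {G : Env Op} {v : Val Op} {A B : VTy Op} {v' : ExEff.Val Op} {g : ExEff.Co Op} :
      ElabVal Sg G v A v' → Entails Sg G g (.simple (.vty A B)) →
      ElabVal Sg G v B (.cast v' g)
  | unit {G : Env Op} : ElabVal Sg G .unit .unit .unit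
  | lam {G : Env Op} {c : Comp Op} {A : VTy Op} {C : CTy Op} {c' : ExEff.Comp Op} {t : Skel}
      {T : ExEff.VTy Op} :
      ElabComp Sg (G.tm A.mono) c C c' → WfVTy Sg G A t T →
      ElabVal Sg G (.lam c) (.arr A C) (.lam T c')
  | hand {G : Env Op} {c : Comp Op} {cls : Clauses Op} {A B : VTy Op} {D : Dirt Op}
      {c' : ExEff.Comp Op} {cls' : ExEff.Clauses Op} {t : Skel} {T : ExEff.VTy Op} :
      ElabComp Sg (G.tm A.mono) c (.mk B D) c' → WfVTy Sg G A t T →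
      ElabClauses Sg G B D cls cls' →
      ElabVal Sg G (.hand c cls) (.hand (.mk A (.union cls.ops D)) (.mk B D))
        (.hand T c' cls')
/-- `Γ ⊢ c : C ⇝ c'` -/
inductive ElabComp (Sg : Sig Op) : Env Op → Comp Op → CTy Op → ExEff.Comp Op → Prop
  | cast {G : Env Op} {c : Comp Op} {C₁ C₂ : CTy Op} {c' : ExEff.Comp Op} {g : ExEff.Co Op} :
      ElabComp Sg G c C₁ c' → Entails Sg G g (.cty C₁ C₂) → ElabComp Sg G c C₂ (.cast c' g)
  | app {G : Env Op} {v₁ v₂ : Val Op} {A : VTy Op} {C : CTy Op} {v₁' v₂' : ExEff.Val Op} :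
      ElabVal Sg G v₁ (.arr A C) v₁' → ElabVal Sg G v₂ A v₂' →
      ElabComp Sg G (.app v₁ v₂) C (.app v₁' v₂')
  /- The constraints are well formed in the scope of the quantified variables; `ps'` are their
  explicit counterparts. -/
  | letv {G : Env Op} {m q : ℕ} {ts : List Skel} {ps : List (SCt Op)}
      {ps' : List (ExEff.SCt Op)} {A : VTy Op} {v : Val Op} {c : Comp Op} {C : CTy Op}
      {v' : ExEff.Val Op} {c' : ExEff.Comp Op} :
      List.Forall₂ (WfSCt Sg (Env.dirt^[q] ((Env.skel^[m] G).tys ts))) ps ps' →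
      ElabVal Sg ((Env.dirt^[q] ((Env.skel^[m] G).tys ts)).cos ps) v A v' →
      ElabComp Sg (G.tm (scheme m ts q ps A)) c C c' →
      ElabComp Sg G (.letv v c) C (.letv (v'.gen m (ts.map Skel.toEx) q ps') c')
  | ret {G : Env Op} {v : Val Op} {A : VTy Op} {v' : ExEff.Val Op} :
      ElabVal Sg G v A v' → ElabComp Sg G (.ret v) (.mk A .empty) (.ret v')
  | op {G : Env Op} {o : Op} {v : Val Op} {c : Comp Op} {A₁ B₁ A : VTy Op} {D : Dirt Op}
      {v' : ExEff.Val Op} {c' : ExEff.Comp Op} {t : Skel} {T : ExEff.VTy Op} :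
      Sg o = some (A₁, B₁) → ElabVal Sg G v A₁ v' →
      ElabComp Sg (G.tm B₁.mono) c (.mk A D) c' → WfVTy Sg G B₁ t T → o ∈ D.ops →
      ElabComp Sg G (.op o v c) (.mk A D) (.op o v' T c')
  | seq {G : Env Op} {c₁ c₂ : Comp Op} {A B : VTy Op} {D : Dirt Op} {c₁' c₂' : ExEff.Comp Op} :
      ElabComp Sg G c₁ (.mk A D) c₁' → ElabComp Sg (G.tm A.mono) c₂ (.mk B D) c₂' →
      ElabComp Sg G (.seq c₁ c₂) (.mk B D) (.seq c₁' c₂')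
  | handle {G : Env Op} {v : Val Op} {c : Comp Op} {C D : CTy Op} {v' : ExEff.Val Op}
      {c' : ExEff.Comp Op} :
      ElabVal Sg G v (.hand C D) v' → ElabComp Sg G c C c' →
      ElabComp Sg G (.handle v c) D (.handle v' c')
/-- Typing and elaboration of the operation clauses of a handler with result type `B ! Δ`; no
operation has two clauses. -/
inductive ElabClauses (Sg : Sig Op) :
    Env Op → VTy Op → Dirt Op → Clauses Op → ExEff.Clauses Op → Prop
  | nil {G : Env Op} {B : VTy Op} {D : Dirt Op} : ElabClauses Sg G B D .nil .nil
  | cons {G : Env Op} {B A₁ B₁ : VTy Op} {D : Dirt Op} {o : Op} {c : Comp Op}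
      {cls : Clauses Op} {c' : ExEff.Comp Op} {cls' : ExEff.Clauses Op} :
      Sg o = some (A₁, B₁) →
      ElabComp Sg ((G.tm A₁.mono).tm (VTy.arr B₁ (.mk B D)).mono) c (.mk B D) c' →
      o ∉ cls.ops → ElabClauses Sg G B D cls cls' →
      ElabClauses Sg G B D (.cons o c cls) (.cons o c' cls')
end

end ImpEff

-- The proof is an induction on the elaboration derivation, simultaneous for values, computations
-- and handler clauses. Most rules have a single explicit counterpart whose premises are the
-- translated implicit ones: an entailment witness already is a coercion for the translated
-- constraint (`Entails.toEx`), and an annotation inserted in a term is the translation of the type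
-- it annotates (`WfVTy.eq_toEx`).
--
-- Two rules do several things at once. Generalization at a `let` introduces a whole block of
-- quantifiers, where the explicit term has one abstraction per binder; `valTy_gen` rebuilds these
-- block by block from the inside. The variable rule is the harder one: it applies one simultaneous
-- substitution to the body of a scheme, whereas the explicit term is a spine of applications, each
-- substituting for one bound variable. Every type met along this spine is the translation of
-- `S[σ]`, where `S` is what is left of the scheme after removing outer quantifiers and `σ` collects
-- the arguments supplied so far. Moving `σ` under a quantifier lifts it, and instantiating the
-- bound variable with `t` afterwards yields `σ` extended by `t`. This is the content of
-- `PTy.toEx_instSkel`, `PTy.toEx_instTy` and `PTy.toEx_instDirt`; iterating it from the identity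
-- substitution ends at the substitution of the variable rule.
--
-- The composition law behind this is proved for implicit types only (`PTy.subst_subst`) and
-- transported by `PTy.toEx_subst`. Implicit monotypes bind no variables and mention no skeleton
-- variables, so lifting occurs only at the prenex quantifiers, and no composition law for explicit
-- types is needed.

universe w

/-! ### Substitution in dirts -/

namespace Dirt

variable {Op : Type w}

@[simp] theorem rename_id (D : Dirt Op) : D.rename id = D := by
  cases D; simp [rename]

variable [DecidableEq Op]

@[simp] theorem subst_var (D : Dirt Op) : D.subst .var = D := by
  rcases D with ⟨O, _ | d⟩ <;> simp [subst, union, var]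

theorem subst_rename (f : ℕ → ℕ) (s : ℕ → Dirt Op) (D : Dirt Op) :
    (D.rename f).subst s = D.subst (fun n => s (f n)) := by
  rcases D with ⟨O, _ | d⟩ <;> rfl

theorem rename_subst (f : ℕ → ℕ) (s : ℕ → Dirt Op) (D : Dirt Op) :
    (D.subst s).rename f = D.subst (fun n => (s n).rename f) := by
  rcases D with ⟨O, _ | d⟩ <;> rfl

theorem subst_subst (s s' : ℕ → Dirt Op) (D : Dirt Op) :
    (D.subst s).subst s' = D.subst (fun n => (s n).subst s') := by
  rcases D with ⟨O, _ | d⟩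
  · rfl
  -- Both substitutions contribute operations; the two sides differ only in how the unions are
  -- bracketed.
  · rcases h : s d with ⟨O', _ | d'⟩ <;> simp [subst, union, h, Finset.union_assoc]

end Dirt

namespace ImpEff

variable {Op : Type w}

/-! ### Substitution in skeletons and monotypes -/

namespace Skel

theorem subst_var (t : Skel) : t.subst .var = t := by
  induction t <;> simp_all [subst]

theorem subst_rename (f : ℕ → ℕ) (s : ℕ → Skel) (t : Skel) :
    (t.rename f).subst s = t.subst (fun n => s (f n)) := by
  induction t <;> simp_all [subst, rename]

theorem rename_subst (f : ℕ → ℕ) (s : ℕ → Skel) (t : Skel) :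
    (t.subst s).rename f = t.subst (fun n => (s n).rename f) := by
  induction t <;> simp_all [subst, rename]

theorem subst_subst (s s' : ℕ → Skel) (t : Skel) :
    (t.subst s).subst s' = t.subst (fun n => (s n).subst s') := by
  induction t <;> simp_all [subst]

theorem toEx_rename (f : ℕ → ℕ) (t : Skel) : (t.rename f).toEx = t.toEx.rename f := by
  induction t <;> simp_all [rename, toEx, ExEff.Skel.rename]

theorem toEx_subst (s : ℕ → Skel) (t : Skel) :
    (t.subst s).toEx = t.toEx.subst (fun n => (s n).toEx) := by
  induction t <;> simp_all [subst, toEx, ExEff.Skel.subst]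

end Skel

mutual
-- The skeleton renaming `fs` is arbitrary: skeletons occur only as annotations of type quantifiers,
-- which a translated monotype does not have.
theorem VTy.toEx_rename (fs ft fd : ℕ → ℕ) :
    ∀ A : VTy Op, (A.rename ft fd).toEx = A.toEx.rename fs ft fd
  | .var a => by simp [VTy.rename, VTy.toEx, ExEff.VTy.rename]
  | .unit => by simp [VTy.rename, VTy.toEx, ExEff.VTy.rename]
  | .arr A C => by
    simp [VTy.rename, VTy.toEx, ExEff.VTy.rename, VTy.toEx_rename fs ft fd A,
      CTy.toEx_rename fs ft fd C]
  | .hand C D => by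
    simp [VTy.rename, VTy.toEx, ExEff.VTy.rename, CTy.toEx_rename fs ft fd C,
      CTy.toEx_rename fs ft fd D]
theorem CTy.toEx_rename (fs ft fd : ℕ → ℕ) :
    ∀ C : CTy Op, (C.rename ft fd).toEx = C.toEx.rename fs ft fd
  | .mk A D => by simp [CTy.rename, CTy.toEx, ExEff.CTy.rename, VTy.toEx_rename fs ft fd A]
end

mutual
-- Together with `VTy.toEx_rename`, this shows that shifting skeleton variables fixes a translated
-- monotype. The explicit calculus performs such shifts under a skeleton binder, the implicit one
-- does not.
theorem VTy.rename_id : ∀ A : VTy Op, A.rename id id = A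
  | .var a => by simp [VTy.rename]
  | .unit => by simp [VTy.rename]
  | .arr A C => by simp [VTy.rename, VTy.rename_id A, CTy.rename_id C]
  | .hand C D => by simp [VTy.rename, CTy.rename_id C, CTy.rename_id D]
theorem CTy.rename_id : ∀ C : CTy Op, C.rename id id = C
  | .mk A D => by simp [CTy.rename, VTy.rename_id A]
end

section Subst

variable [DecidableEq Op]

mutual
theorem VTy.subst_var : ∀ A : VTy Op, A.subst .var .var = A
  | .var a => by simp [VTy.subst]
  | .unit => by simp [VTy.subst]
  | .arr A C => by simp [VTy.subst, VTy.subst_var A, CTy.subst_var C]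
  | .hand C D => by simp [VTy.subst, CTy.subst_var C, CTy.subst_var D]
theorem CTy.subst_var : ∀ C : CTy Op, C.subst .var .var = C
  | .mk A D => by simp [CTy.subst, VTy.subst_var A]
end

mutual
theorem VTy.subst_rename (ft fd : ℕ → ℕ) (st : ℕ → VTy Op) (sd : ℕ → Dirt Op) :
    ∀ A : VTy Op,
      (A.rename ft fd).subst st sd = A.subst (fun n => st (ft n)) (fun n => sd (fd n))
  | .var a => by simp [VTy.rename, VTy.subst]
  | .unit => by simp [VTy.rename, VTy.subst]
  | .arr A C => by
    simp [VTy.rename, VTy.subst, VTy.subst_rename ft fd st sd A, CTy.subst_rename ft fd st sd C]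
  | .hand C D => by
    simp [VTy.rename, VTy.subst, CTy.subst_rename ft fd st sd C, CTy.subst_rename ft fd st sd D]
theorem CTy.subst_rename (ft fd : ℕ → ℕ) (st : ℕ → VTy Op) (sd : ℕ → Dirt Op) :
    ∀ C : CTy Op,
      (C.rename ft fd).subst st sd = C.subst (fun n => st (ft n)) (fun n => sd (fd n))
  | .mk A D => by
    simp [CTy.rename, CTy.subst, VTy.subst_rename ft fd st sd A, Dirt.subst_rename]
end

mutual
theorem VTy.rename_subst (ft fd : ℕ → ℕ) (st : ℕ → VTy Op) (sd : ℕ → Dirt Op) :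
    ∀ A : VTy Op, (A.subst st sd).rename ft fd =
      A.subst (fun n => (st n).rename ft fd) (fun n => (sd n).rename fd)
  | .var a => by simp [VTy.subst]
  | .unit => by simp [VTy.rename, VTy.subst]
  | .arr A C => by
    simp [VTy.rename, VTy.subst, VTy.rename_subst ft fd st sd A, CTy.rename_subst ft fd st sd C]
  | .hand C D => by
    simp [VTy.rename, VTy.subst, CTy.rename_subst ft fd st sd C, CTy.rename_subst ft fd st sd D]
theorem CTy.rename_subst (ft fd : ℕ → ℕ) (st : ℕ → VTy Op) (sd : ℕ → Dirt Op) :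
    ∀ C : CTy Op, (C.subst st sd).rename ft fd =
      C.subst (fun n => (st n).rename ft fd) (fun n => (sd n).rename fd)
  | .mk A D => by
    simp [CTy.rename, CTy.subst, VTy.rename_subst ft fd st sd A, Dirt.rename_subst]
end

mutual
theorem VTy.subst_subst (st st' : ℕ → VTy Op) (sd sd' : ℕ → Dirt Op) :
    ∀ A : VTy Op, (A.subst st sd).subst st' sd' =
      A.subst (fun n => (st n).subst st' sd') (fun n => (sd n).subst sd')
  | .var a => by simp [VTy.subst]
  | .unit => by simp [VTy.subst]
  | .arr A C => by
    simp [VTy.subst, VTy.subst_subst st st' sd sd' A, CTy.subst_subst st st' sd sd' C]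
  | .hand C D => by
    simp [VTy.subst, CTy.subst_subst st st' sd sd' C, CTy.subst_subst st st' sd sd' D]
theorem CTy.subst_subst (st st' : ℕ → VTy Op) (sd sd' : ℕ → Dirt Op) :
    ∀ C : CTy Op, (C.subst st sd).subst st' sd' =
      C.subst (fun n => (st n).subst st' sd') (fun n => (sd n).subst sd')
  | .mk A D => by simp [CTy.subst, VTy.subst_subst st st' sd sd' A, Dirt.subst_subst]
end

mutual
-- As for renaming, `ss` is free because there are no skeletons in a monotype on which it could act.
theorem VTy.toEx_subst (ss : ℕ → ExEff.Skel) (st : ℕ → VTy Op) (sd : ℕ → Dirt Op) :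
    ∀ A : VTy Op, (A.subst st sd).toEx = A.toEx.subst ss (fun n => (st n).toEx) sd
  | .var a => by simp [VTy.subst, VTy.toEx, ExEff.VTy.subst]
  | .unit => by simp [VTy.subst, VTy.toEx, ExEff.VTy.subst]
  | .arr A C => by
    simp [VTy.subst, VTy.toEx, ExEff.VTy.subst, VTy.toEx_subst ss st sd A,
      CTy.toEx_subst ss st sd C]
  | .hand C D => by
    simp [VTy.subst, VTy.toEx, ExEff.VTy.subst, CTy.toEx_subst ss st sd C,
      CTy.toEx_subst ss st sd D]
theorem CTy.toEx_subst (ss : ℕ → ExEff.Skel) (st : ℕ → VTy Op) (sd : ℕ → Dirt Op) :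
    ∀ C : CTy Op, (C.subst st sd).toEx = C.toEx.subst ss (fun n => (st n).toEx) sd
  | .mk A D => by simp [CTy.subst, CTy.toEx, ExEff.CTy.subst, VTy.toEx_subst ss st sd A]
end

/-! ### Substitution in constraints, qualified types and polytypes -/

theorem SCt.subst_var (p : SCt Op) : p.subst .var .var = p := by
  cases p <;> simp [SCt.subst, VTy.subst_var]

theorem SCt.subst_subst (st st' : ℕ → VTy Op) (sd sd' : ℕ → Dirt Op) (p : SCt Op) :
    (p.subst st sd).subst st' sd' =
      p.subst (fun n => (st n).subst st' sd') (fun n => (sd n).subst sd') := by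
  cases p <;> simp [SCt.subst, VTy.subst_subst, Dirt.subst_subst]

theorem SCt.toEx_subst (ss : ℕ → ExEff.Skel) (st : ℕ → VTy Op) (sd : ℕ → Dirt Op) (p : SCt Op) :
    (p.subst st sd).toEx = p.toEx.subst ss (fun n => (st n).toEx) sd := by
  cases p <;> simp [SCt.subst, SCt.toEx, ExEff.SCt.subst, VTy.toEx_subst ss]

/-- The implicit typing rules substitute only in monotypes and simple constraints. Substitution in
qualified types and polytypes serves to describe schemes that are instantiated only in part. -/
def QTy.subst (st : ℕ → VTy Op) (sd : ℕ → Dirt Op) : QTy Op → QTy Op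
  | .ty A => .ty (A.subst st sd)
  | .qual p K => .qual (p.subst st sd) (K.subst st sd)

theorem QTy.subst_var (K : QTy Op) : K.subst .var .var = K := by
  induction K <;> simp_all [QTy.subst, VTy.subst_var, SCt.subst_var]

theorem QTy.subst_subst (st st' : ℕ → VTy Op) (sd sd' : ℕ → Dirt Op) (K : QTy Op) :
    (K.subst st sd).subst st' sd' =
      K.subst (fun n => (st n).subst st' sd') (fun n => (sd n).subst sd') := by
  induction K <;> simp_all [QTy.subst, VTy.subst_subst, SCt.subst_subst]

theorem QTy.toEx_subst (ss : ℕ → ExEff.Skel) (st : ℕ → VTy Op) (sd : ℕ → Dirt Op) (K : QTy Op) :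
    (K.subst st sd).toEx = K.toEx.subst ss (fun n => (st n).toEx) sd := by
  induction K <;>
    simp_all [QTy.subst, QTy.toEx, ExEff.VTy.subst, VTy.toEx_subst ss, SCt.toEx_subst ss]

/-- Capture-avoiding simultaneous substitution in polytypes. -/
def PTy.subst : (ℕ → Skel) → (ℕ → VTy Op) → (ℕ → Dirt Op) → PTy Op → PTy Op
  | _, st, sd, .qty K => .qty (K.subst st sd)
  | ss, st, sd, .allSkel S =>
      .allSkel (S.subst (scons (.var 0) (fun n => (ss n).rename (· + 1))) st sd)
  | ss, st, sd, .allTy t S =>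
      .allTy (t.subst ss) (S.subst ss (scons (.var 0) (fun n => (st n).rename (· + 1) id)) sd)
  | ss, st, sd, .allDirt S =>
      .allDirt (S.subst ss (fun n => (st n).rename id (· + 1))
        (scons (.var 0) (fun n => (sd n).rename (· + 1))))

/-- Lifting the identity substitution under a binder gives the identity again; the general `v`
covers all three sorts of variables. -/
theorem scons_var_zero {X : Type*} {v g : ℕ → X} (h : ∀ n, g n = v (n + 1)) :
    scons (v 0) g = v := by
  funext n
  cases n <;> simp [scons, h]

theorem PTy.subst_var (S : PTy Op) : S.subst .var .var .var = S := by
  induction S with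
  | qty K => simp [PTy.subst, QTy.subst_var]
  | allSkel S ih => simp [PTy.subst, scons_var_zero (v := Skel.var), Skel.rename, ih]
  | allTy t S ih =>
    simp [PTy.subst, Skel.subst_var, scons_var_zero (v := VTy.var), VTy.rename, ih]
  | allDirt S ih =>
    have e : scons (.var 0) (fun n => (Dirt.var n : Dirt Op).rename (· + 1)) = Dirt.var :=
      scons_var_zero fun _ => rfl
    simp only [PTy.subst, VTy.rename, e]
    exact congrArg _ ih

theorem PTy.subst_subst (ss ss' : ℕ → Skel) (st st' : ℕ → VTy Op) (sd sd' : ℕ → Dirt Op)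
    (S : PTy Op) :
    (S.subst ss st sd).subst ss' st' sd' =
      S.subst (fun n => (ss n).subst ss') (fun n => (st n).subst st' sd')
        (fun n => (sd n).subst sd') := by
  induction S generalizing ss ss' st st' sd sd' with
  | qty K => simp [PTy.subst, QTy.subst_subst]
  | allSkel S ih =>
    simp only [PTy.subst, ih]
    -- Lifting commutes with composition: index `0` is the bound variable on both sides, and at `n +
    -- 1` the shift is absorbed by the lifted second substitution. The two cases below follow the
    -- same pattern.
    congr 2
    funext n
    cases n <;> simp [scons, Skel.subst, Skel.subst_rename, Skel.rename_subst]
  | allTy t S ih =>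
    simp only [PTy.subst, ih, Skel.subst_subst]
    congr 2
    funext n
    cases n <;> simp [scons, VTy.subst, VTy.subst_rename, VTy.rename_subst]
  | allDirt S ih =>
    simp only [PTy.subst, ih]
    congr 2
    · funext n
      simp [scons, VTy.subst_rename, VTy.rename_subst]
    · funext n
      cases n <;> simp [scons, Dirt.subst_rename, Dirt.rename_subst]
      simp [Dirt.subst, Dirt.var, Dirt.union, scons]

theorem PTy.toEx_subst (ss : ℕ → Skel) (st : ℕ → VTy Op) (sd : ℕ → Dirt Op) (S : PTy Op) :
    (S.subst ss st sd).toEx =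
      S.toEx.subst (fun n => (ss n).toEx) (fun n => (st n).toEx) sd := by
  induction S generalizing ss st sd with
  | qty K => exact QTy.toEx_subst _ st sd K
  | allSkel S ih =>
    simp only [PTy.subst, PTy.toEx, ExEff.VTy.subst, ih]
    congr 2
    · funext n
      cases n <;> simp [scons, Skel.toEx, Skel.toEx_rename]
    · funext n
      -- The explicit substitution shifts the skeleton variables of the types it carries; on
      -- translated monotypes this has no effect.
      rw [← VTy.toEx_rename, VTy.rename_id]
  | allTy t S ih =>
    simp only [PTy.subst, PTy.toEx, ExEff.VTy.subst, ih, Skel.toEx_subst]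
    congr 2
    funext n
    cases n <;> simp [scons, VTy.toEx, VTy.toEx_rename id]
  | allDirt S ih =>
    simp only [PTy.subst, PTy.toEx, ExEff.VTy.subst, ih]
    congr 2
    funext n
    simp [VTy.toEx_rename id]

/-! ### Instantiation of the outermost quantifier -/

/-- Composing the lift of `ss` with the instantiation of index `0` sends `0` to `t`, and at `n + 1`
the shift cancels, leaving `ss n`. Hence one explicit application extends the accumulated
substitution by one entry. -/
theorem PTy.toEx_instSkel (S : PTy Op) (t : Skel) (ss : ℕ → Skel) (st : ℕ → VTy Op)
    (sd : ℕ → Dirt Op) :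
    (S.subst (scons (.var 0) (fun n => (ss n).rename (· + 1))) st sd).toEx.instSkel t.toEx =
      (S.subst (scons t ss) st sd).toEx := by
  have h := PTy.subst_subst (scons (.var 0) (fun n => (ss n).rename (· + 1))) (scons t .var)
    st .var sd .var S
  have e : (fun n => (scons (.var 0) (fun n => (ss n).rename (· + 1)) n).subst (scons t .var)) =
      scons t ss := by
    funext n
    cases n <;> simp [scons, Skel.subst, Skel.subst_rename, Skel.subst_var]
  simp only [e, VTy.subst_var, Dirt.subst_var] at h
  rw [← h, PTy.toEx_subst (scons t .var), ExEff.VTy.instSkel]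
  congr 1
  funext n
  cases n <;> rfl

theorem PTy.toEx_instTy (S : PTy Op) (A : VTy Op) (ss : ℕ → Skel) (st : ℕ → VTy Op)
    (sd : ℕ → Dirt Op) :
    (S.subst ss (scons (.var 0) (fun n => (st n).rename (· + 1) id)) sd).toEx.instTy A.toEx =
      (S.subst ss (scons A st) sd).toEx := by
  have h := PTy.subst_subst ss .var (scons (.var 0) (fun n => (st n).rename (· + 1) id))
    (scons A .var) sd .var S
  have e : (fun n => (scons (.var 0) (fun n => (st n).rename (· + 1) id) n).subst
      (scons A .var) .var) = scons A st := by
    funext n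
    cases n <;> simp [scons, VTy.subst, VTy.subst_rename, VTy.subst_var]
  simp only [e, Skel.subst_var, Dirt.subst_var] at h
  rw [← h, PTy.toEx_subst _ (scons A .var), ExEff.VTy.instTy]
  congr 1
  funext n
  cases n <;> simp [scons, VTy.toEx]

theorem PTy.toEx_instDirt (S : PTy Op) (D : Dirt Op) (ss : ℕ → Skel) (st : ℕ → VTy Op)
    (sd : ℕ → Dirt Op) :
    (S.subst ss (fun n => (st n).rename id (· + 1))
      (scons (.var 0) (fun n => (sd n).rename (· + 1)))).toEx.instDirt D =
      (S.subst ss st (scons D sd)).toEx := by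
  have h := PTy.subst_subst ss .var (fun n => (st n).rename id (· + 1)) .var
    (scons (.var 0) (fun n => (sd n).rename (· + 1))) (scons D .var) S
  have e : (fun n => (scons (.var 0) (fun n => (sd n).rename (· + 1)) n).subst
      (scons D .var)) = scons D sd := by
    funext n
    cases n <;> simp [scons, Dirt.subst_rename]
    simp [Dirt.subst, Dirt.var, Dirt.union, scons]
  -- Unlike the other two quantifiers, a dirt quantifier also shifts `st`, since monotypes contain
  -- dirt variables; this shift has to cancel too.
  have e' : (fun n => ((st n).rename id (· + 1)).subst .var (scons D .var)) = st := by
    funext n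
    rw [VTy.subst_rename]
    exact VTy.subst_var (st n)
  simp only [e, e', Skel.subst_var] at h
  rw [← h, PTy.toEx_subst _ _ (scons D .var), ExEff.VTy.instDirt]
  rfl

end Subst

/-! ### Translation of environments -/

theorem SCt.toEx_rename (fs ft fd : ℕ → ℕ) (p : SCt Op) :
    (p.rename ft fd).toEx = p.toEx.rename fs ft fd := by
  cases p <;> simp [SCt.rename, SCt.toEx, ExEff.SCt.rename, VTy.toEx_rename fs]

theorem SCt.rename_id (p : SCt Op) : p.rename id id = p := by
  cases p <;> simp [SCt.rename, VTy.rename_id]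

theorem QTy.toEx_rename (fs ft fd : ℕ → ℕ) (K : QTy Op) :
    (K.rename ft fd).toEx = K.toEx.rename fs ft fd := by
  induction K <;>
    simp_all [QTy.rename, QTy.toEx, ExEff.VTy.rename, VTy.toEx_rename fs, SCt.toEx_rename fs]

theorem PTy.toEx_rename (fs ft fd : ℕ → ℕ) (S : PTy Op) :
    (S.rename fs ft fd).toEx = S.toEx.rename fs ft fd := by
  induction S generalizing fs ft fd <;>
    simp_all [PTy.rename, PTy.toEx, ExEff.VTy.rename, QTy.toEx_rename fs, Skel.toEx_rename]

theorem HasSkel.toEx {G : Env Op} {s : ℕ} (h : HasSkel G s) : ExEff.HasSkel G.toEx s := by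
  induction h <;> constructor <;> assumption

theorem HasDirt.toEx {G : Env Op} {d : ℕ} (h : HasDirt G d) : ExEff.HasDirt G.toEx d := by
  induction h <;> constructor <;> assumption

theorem HasTy.toEx {G : Env Op} {a : ℕ} {t : Skel} (h : HasTy G a t) :
    ExEff.HasTy G.toEx a t.toEx := by
  induction h with
  | skel _ ih => rw [Skel.toEx_rename]; exact .skel ih
  | _ => constructor <;> assumption

theorem HasTm.toEx {G : Env Op} {x : ℕ} {S : PTy Op} (h : HasTm G x S) :
    ExEff.HasTm G.toEx x S.toEx := by
  induction h with
  | skel _ ih => rw [PTy.toEx_rename]; exact .skel ih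
  | ty _ ih => rw [PTy.toEx_rename]; exact .ty ih
  | dirt _ ih => rw [PTy.toEx_rename]; exact .dirt ih
  | _ => constructor <;> assumption

theorem HasCo.toEx {G : Env Op} {w : ℕ} {p : SCt Op} (h : HasCo G w p) :
    ExEff.HasCo G.toEx w p.toEx := by
  induction h with
  | @skel G w p _ ih =>
    -- The implicit entry stays unchanged under a skeleton binder while the explicit one is shifted,
    -- so a trivial renaming is inserted for the translation to act on.
    rw [← SCt.rename_id p, SCt.toEx_rename (· + 1)]
    exact .skel ih
  | ty _ ih => rw [SCt.toEx_rename id]; exact .ty ih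
  | dirt _ ih => rw [SCt.toEx_rename id]; exact .dirt ih
  | _ => constructor <;> assumption

theorem Sig.toEx_eq_some {Sg : Sig Op} {o : Op} {A B : VTy Op} (h : Sg o = some (A, B)) :
    Sg.toEx o = some (A.toEx, B.toEx) := by
  simp [Sig.toEx, h]

/-! ### Translation of well-formedness and entailment -/

theorem WfSkel.toEx {G : Env Op} {t : Skel} (h : WfSkel G t) : ExEff.WfSkel G.toEx t.toEx := by
  induction h with
  | var h => exact .var h.toEx
  | _ => constructor <;> assumption

variable [DecidableEq Op] {Sg : Sig Op}

theorem WfDirt.toEx {G : Env Op} {D : Dirt Op} (h : WfDirt Sg G D) :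
    ExEff.WfDirt Sg.toEx G.toEx D := by
  induction h with
  | empty => exact .empty
  | var h => exact .var h.toEx
  | cons h _ ih => exact .cons (Sig.toEx_eq_some h) ih

/-- Needed for generalization: the `let` rule checks all constraints before any coercion variable is
bound, but nested coercion abstractions check each one in the scope of its predecessors. Types do
not mention coercion variables, so nothing is renamed. -/
theorem WfDirt.weaken_co {G : Env Op} {D : Dirt Op} (p : SCt Op) (h : WfDirt Sg G D) :
    WfDirt Sg (G.co p) D := by
  induction h with
  | empty => exact .empty
  | var h => exact .var (.co h)
  | cons h _ ih => exact .cons h ih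

mutual
theorem WfVTy.weaken_co (p : SCt Op) : ∀ {G : Env Op} {A : VTy Op} {t : Skel} {T : ExEff.VTy Op},
    WfVTy Sg G A t T → WfVTy Sg (G.co p) A t T
  | _, _, _, _, .var h => .var (.co h)
  | _, _, _, _, .arr h₁ h₂ => .arr (h₁.weaken_co p) (h₂.weaken_co p)
  | _, _, _, _, .hand h₁ h₂ => .hand (h₁.weaken_co p) (h₂.weaken_co p)
  | _, _, _, _, .unit => .unit
theorem WfCTy.weaken_co (p : SCt Op) : ∀ {G : Env Op} {C : CTy Op} {t : Skel} {C' : ExEff.CTy Op},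
    WfCTy Sg G C t C' → WfCTy Sg (G.co p) C t C'
  | _, _, _, _, .mk h₁ h₂ => .mk (h₁.weaken_co p) (h₂.weaken_co p)
end

theorem WfSCt.weaken_co (p : SCt Op) {G : Env Op} {p₁ : SCt Op} {p' : ExEff.SCt Op}
    (h : WfSCt Sg G p₁ p') : WfSCt Sg (G.co p) p₁ p' := by
  cases h with
  | vty h₁ h₂ => exact .vty (h₁.weaken_co p) (h₂.weaken_co p)
  | dirt h₁ h₂ => exact .dirt (h₁.weaken_co p) (h₂.weaken_co p)

mutual
theorem WfVTy.eq_toEx : ∀ {G : Env Op} {A : VTy Op} {t : Skel} {T : ExEff.VTy Op},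
    WfVTy Sg G A t T → T = A.toEx
  | _, _, _, _, .var _ => by simp [VTy.toEx]
  | _, _, _, _, .arr h₁ h₂ => by simp [VTy.toEx, h₁.eq_toEx, h₂.eq_toEx]
  | _, _, _, _, .hand h₁ h₂ => by simp [VTy.toEx, h₁.eq_toEx, h₂.eq_toEx]
  | _, _, _, _, .unit => by simp [VTy.toEx]
theorem WfCTy.eq_toEx : ∀ {G : Env Op} {C : CTy Op} {t : Skel} {C' : ExEff.CTy Op},
    WfCTy Sg G C t C' → C' = C.toEx
  | _, _, _, _, .mk h₁ _ => by simp [CTy.toEx, h₁.eq_toEx]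
end

mutual
theorem WfVTy.toEx : ∀ {G : Env Op} {A : VTy Op} {t : Skel} {T : ExEff.VTy Op},
    WfVTy Sg G A t T → ExEff.WfVTy Sg.toEx G.toEx T t.toEx
  | _, _, _, _, .var h => .var h.toEx
  | _, _, _, _, .arr h₁ h₂ => .arr h₁.toEx h₂.toEx
  | _, _, _, _, .hand h₁ h₂ => .hand h₁.toEx h₂.toEx
  | _, _, _, _, .unit => .unit
theorem WfCTy.toEx : ∀ {G : Env Op} {C : CTy Op} {t : Skel} {C' : ExEff.CTy Op},
    WfCTy Sg G C t C' → ExEff.WfCTy Sg.toEx G.toEx C' t.toEx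
  | _, _, _, _, .mk h₁ h₂ => .mk h₁.toEx h₂.toEx
end

theorem WfSCt.eq_toEx {G : Env Op} {p : SCt Op} {p' : ExEff.SCt Op} (h : WfSCt Sg G p p') :
    p' = p.toEx := by
  cases h with
  | vty h₁ h₂ => simp [SCt.toEx, h₁.eq_toEx, h₂.eq_toEx]
  | dirt h₁ h₂ => rfl

theorem WfSCt.toEx {G : Env Op} {p : SCt Op} {p' : ExEff.SCt Op} (h : WfSCt Sg G p p') :
    ExEff.WfSCt Sg.toEx G.toEx p' := by
  cases h with
  | vty h₁ h₂ => exact .vty h₁.toEx h₂.toEx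
  | dirt h₁ h₂ => exact .dirt h₁.toEx h₂.toEx

def Ct.toEx : Ct Op → ExEff.Ct Op
  | .simple p => .simple p.toEx
  | .cty C D => .cty C.toEx D.toEx

/-- The entailment rules are among the coercion typing rules; the explicit congruences for
quantified and qualified types never arise. -/
theorem Entails.toEx {G : Env Op} {g : ExEff.Co Op} {r : Ct Op} (h : Entails Sg G g r) :
    ExEff.CoTy Sg.toEx G.toEx g r.toEx := by
  induction h with
  | var h => exact .var h.toEx
  | unit => simpa [Ct.toEx, SCt.toEx, VTy.toEx] using .unit
  | tyRefl h =>
    simp only [Ct.toEx, SCt.toEx, VTy.toEx]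
    exact .tyRefl (.var h.toEx)
  | dirtRefl h => exact .dirtRefl h.toEx
  | arr _ _ ih₁ ih₂ =>
    simp only [Ct.toEx, SCt.toEx, VTy.toEx]
    exact .arr ih₁ ih₂
  | hand _ _ ih₁ ih₂ =>
    simp only [Ct.toEx, SCt.toEx, VTy.toEx]
    exact .hand ih₁ ih₂
  | comp _ _ ih₁ ih₂ =>
    simp only [Ct.toEx, CTy.toEx]
    exact .comp ih₁ ih₂
  | dirtNil h => exact .dirtNil h.toEx
  | dirtOp _ h ih => exact .dirtOp ih (Sig.toEx_eq_some h)

/-! ### Generalization and instantiation of polymorphic values -/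

theorem valTy_lamCos {G : Env Op} {ps : List (SCt Op)} {ps' : List (ExEff.SCt Op)} {A : VTy Op}
    {v : ExEff.Val Op} (hps : List.Forall₂ (WfSCt Sg G) ps ps')
    (hv : ExEff.ValTy Sg.toEx (G.cos ps).toEx v A.toEx) :
    ExEff.ValTy Sg.toEx G.toEx (ps'.foldr .lamCo v) (ps.foldr .qual (.ty A) : QTy Op).toEx := by
  induction ps generalizing G ps' with
  | nil => cases hps; exact hv
  | cons p ps ih =>
    cases hps with
    | cons h hs =>
      -- The remaining constraints are transported into the scope of the first coercion variable.
      have := ih (G := G.co p) (hs.imp fun _ _ h => h.weaken_co p) hv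
      have e := h.eq_toEx
      subst e
      exact .lamCo this h.toEx

theorem valTy_lamDirts {G : Env Op} {q : ℕ} {S : PTy Op} {v : ExEff.Val Op}
    (hv : ExEff.ValTy Sg.toEx (Env.dirt^[q] G).toEx v S.toEx) :
    ExEff.ValTy Sg.toEx G.toEx (ExEff.Val.lamDirt^[q] v) (PTy.allDirt^[q] S).toEx := by
  induction q generalizing G with
  | zero => exact hv
  | succ q ih =>
    -- The outermost abstraction binds the entry added to `G` first, so the induction hypothesis is
    -- used at `G.dirt`: the iterate is unrolled at its outer end on terms and types, but at its
    -- inner end on the environment.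
    rw [Function.iterate_succ_apply'] at *
    rw [Function.iterate_succ_apply']
    exact .lamDirt (ih (G := G.dirt) (by
      rwa [← Function.iterate_succ_apply, Function.iterate_succ_apply']))

theorem valTy_lamSkels {G : Env Op} {m : ℕ} {S : PTy Op} {v : ExEff.Val Op}
    (hv : ExEff.ValTy Sg.toEx (Env.skel^[m] G).toEx v S.toEx) :
    ExEff.ValTy Sg.toEx G.toEx (ExEff.Val.lamSkel^[m] v) (PTy.allSkel^[m] S).toEx := by
  induction m generalizing G with
  | zero => exact hv
  | succ m ih =>
    rw [Function.iterate_succ_apply'] at *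
    rw [Function.iterate_succ_apply']
    exact .lamSkel (ih (G := G.skel) (by
      rwa [← Function.iterate_succ_apply, Function.iterate_succ_apply']))

theorem valTy_lamTys {G : Env Op} {ts : List Skel} {S : PTy Op} {v : ExEff.Val Op}
    (hv : ExEff.ValTy Sg.toEx (G.tys ts).toEx v S.toEx) :
    ExEff.ValTy Sg.toEx G.toEx ((ts.map Skel.toEx).foldr .lamTy v) (ts.foldr .allTy S).toEx := by
  induction ts generalizing G with
  | nil => exact hv
  | cons t ts ih => exact .lamTy (ih (G := G.ty t) hv)

theorem valTy_gen {G : Env Op} {m q : ℕ} {ts : List Skel} {ps : List (SCt Op)}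
    {ps' : List (ExEff.SCt Op)} {A : VTy Op} {v : ExEff.Val Op}
    (hps : List.Forall₂ (WfSCt Sg (Env.dirt^[q] ((Env.skel^[m] G).tys ts))) ps ps')
    (hv : ExEff.ValTy Sg.toEx ((Env.dirt^[q] ((Env.skel^[m] G).tys ts)).cos ps).toEx v A.toEx) :
    ExEff.ValTy Sg.toEx G.toEx (v.gen m (ts.map Skel.toEx) q ps') (scheme m ts q ps A).toEx :=
  valTy_lamSkels (valTy_lamTys (valTy_lamDirts (valTy_lamCos hps hv)))

/-- The substitution `ss` is an accumulator: each argument is pushed onto it by `PTy.toEx_instSkel`,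
in the order in which `consList` consumes its list. The lemmas for types and dirts work alike. -/
theorem valTy_appSkels {G : Env Op} {S : PTy Op} {ts' : List Skel}
    (hts : ∀ t ∈ ts', WfSkel G t) {ss : ℕ → Skel} {st : ℕ → VTy Op} {sd : ℕ → Dirt Op}
    {v : ExEff.Val Op}
    (hv : ExEff.ValTy Sg.toEx G.toEx v ((PTy.allSkel^[ts'.length] S).subst ss st sd).toEx) :
    ExEff.ValTy Sg.toEx G.toEx ((ts'.map Skel.toEx).foldl .appSkel v)
      (S.subst (consList ts' ss) st sd).toEx := by
  induction ts' generalizing v ss with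
  | nil => exact hv
  | cons t ts' ih =>
    rw [List.length_cons, Function.iterate_succ_apply'] at hv
    refine ih (fun u hu => hts u (List.mem_cons_of_mem _ hu)) ?_
    rw [← PTy.toEx_instSkel]
    exact .appSkel hv (hts t List.mem_cons_self).toEx

/-- The annotations `ts` are instantiated by a fixed `ss`, because skeleton quantifiers precede type
quantifiers in a scheme and the skeleton arguments have all been supplied. -/
theorem valTy_appTys {G : Env Op} {S : PTy Op} {ts : List Skel} {Bs : List (VTy Op)}
    {Ts : List (ExEff.VTy Op)} {ss : ℕ → Skel} {st : ℕ → VTy Op} {sd : ℕ → Dirt Op}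
    (hB : WfVTys Sg G Bs (ts.map (Skel.subst ss)) Ts) {v : ExEff.Val Op}
    (hv : ExEff.ValTy Sg.toEx G.toEx v ((ts.foldr .allTy S : PTy Op).subst ss st sd).toEx) :
    ExEff.ValTy Sg.toEx G.toEx (Ts.foldl .appTy v) (S.subst ss (consList Bs st) sd).toEx := by
  induction ts generalizing v st Bs Ts with
  | nil => cases hB; exact hv
  | cons t ts ih =>
    cases hB with
    | cons h hs =>
      refine ih hs ?_
      rw [← PTy.toEx_instTy, ← h.eq_toEx]
      exact .appTy hv h.toEx

theorem valTy_appDirts {G : Env Op} {S : PTy Op} {Ds : List (Dirt Op)}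
    (hD : ∀ D ∈ Ds, WfDirt Sg G D) {ss : ℕ → Skel} {st : ℕ → VTy Op} {sd : ℕ → Dirt Op}
    {v : ExEff.Val Op}
    (hv : ExEff.ValTy Sg.toEx G.toEx v ((PTy.allDirt^[Ds.length] S).subst ss st sd).toEx) :
    ExEff.ValTy Sg.toEx G.toEx (Ds.foldl .appDirt v) (S.subst ss st (consList Ds sd)).toEx := by
  induction Ds generalizing v sd with
  | nil => exact hv
  | cons D Ds ih =>
    rw [List.length_cons, Function.iterate_succ_apply'] at hv
    refine ih (fun u hu => hD u (List.mem_cons_of_mem _ hu)) ?_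
    rw [← PTy.toEx_instDirt]
    exact .appDirt hv (hD D List.mem_cons_self).toEx

theorem valTy_appCos {G : Env Op} {gs : List (ExEff.Co Op)} {ps : List (SCt Op)} {A : VTy Op}
    {st : ℕ → VTy Op} {sd : ℕ → Dirt Op}
    (hg : List.Forall₂ (fun g p => Entails Sg G g (.simple (p.subst st sd))) gs ps)
    {v : ExEff.Val Op}
    (hv : ExEff.ValTy Sg.toEx G.toEx v ((ps.foldr .qual (.ty A) : QTy Op).subst st sd).toEx) :
    ExEff.ValTy Sg.toEx G.toEx (gs.foldl .appCo v) (A.subst st sd).toEx := by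
  induction hg generalizing v with
  | nil => exact hv
  | cons h _ ih => exact ih (.appCo hv h.toEx)

/-! ### Type preservation -/

/-- The handled operations enter the input dirt of a handler type and the condition that no clause
is repeated, so elaboration has to preserve them. -/
theorem ElabClauses.ops_eq : ∀ {cls : Clauses Op} {cls' : ExEff.Clauses Op} {G : Env Op}
    {B : VTy Op} {D : Dirt Op}, ElabClauses Sg G B D cls cls' → cls'.ops = cls.ops
  | _, _, _, _, _, .nil => rfl
  | _, _, _, _, _, .cons _ _ _ h => by simp [Clauses.ops, ExEff.Clauses.ops, h.ops_eq]

mutual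
theorem ElabVal.toEx : ∀ {G : Env Op} {v : Val Op} {A : VTy Op} {v' : ExEff.Val Op},
    ElabVal Sg G v A v' → ExEff.ValTy Sg.toEx G.toEx v' A.toEx
  | _, _, _, _, .var hx hm hts hB hq hD hg => by
    subst hm hq
    -- Read from the inside out, this is the spine of the elaborated variable. The body is given as
    -- `.qty _` to pass from substitution in polytypes to substitution in qualified types.
    refine valTy_appCos hg (valTy_appDirts (S := .qty _) hD (valTy_appTys hB
      (valTy_appSkels hts ?_)))
    -- Before any argument is supplied the accumulated substitution is the identity, and the type is
    -- the scheme of the variable.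
    rw [PTy.subst_var]
    exact .var hx.toEx
  | _, _, _, _, .cast h hg => .cast h.toEx hg.toEx
  | _, _, _, _, .unit => by simpa [VTy.toEx] using .unit
  | _, _, _, _, .lam h hA => by
    have e := hA.eq_toEx
    subst e
    simp only [VTy.toEx]
    exact .lam h.toEx hA.toEx
  | _, _, _, _, .hand h hA hc => by
    have e := hA.eq_toEx
    subst e
    have h' := h.toEx
    simp only [VTy.toEx, CTy.toEx] at h' ⊢
    rw [← hc.ops_eq]
    exact .hand h' hc.toEx
theorem ElabComp.toEx : ∀ {G : Env Op} {c : Comp Op} {C : CTy Op} {c' : ExEff.Comp Op},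
    ElabComp Sg G c C c' → ExEff.CompTy Sg.toEx G.toEx c' C.toEx
  | _, _, _, _, .cast h hg => .cast h.toEx hg.toEx
  | _, _, _, _, .app h₁ h₂ => by
    have h := h₁.toEx
    simp only [VTy.toEx] at h
    exact .app h h₂.toEx
  | _, _, _, _, .letv hps hv hc => .letv (valTy_gen hps hv.toEx) hc.toEx
  | _, _, _, _, .ret h => by
    simp only [CTy.toEx]
    exact .ret h.toEx
  | _, _, _, _, .op ho hv hc hB hD => by
    have e := hB.eq_toEx
    subst e
    have h := hc.toEx
    simp only [CTy.toEx] at h ⊢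
    exact .op (Sig.toEx_eq_some ho) hv.toEx h hD
  | _, _, _, _, .seq h₁ h₂ => by
    have h₁' := h₁.toEx
    have h₂' := h₂.toEx
    simp only [CTy.toEx] at h₁' h₂' ⊢
    exact .seq h₁' h₂'
  | _, _, _, _, .handle hv hc => by
    have h := hv.toEx
    simp only [VTy.toEx] at h
    exact .handle h hc.toEx
theorem ElabClauses.toEx : ∀ {G : Env Op} {B : VTy Op} {D : Dirt Op} {cls : Clauses Op}
    {cls' : ExEff.Clauses Op},
    ElabClauses Sg G B D cls cls' → ExEff.ClausesTy Sg.toEx G.toEx B.toEx D cls'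
  | _, _, _, _, _, .nil => .nil
  | _, _, _, _, _, .cons ho hc hn h => by
    have h' := hc.toEx
    simp only [CTy.toEx, Env.toEx, VTy.mono, PTy.toEx, QTy.toEx, VTy.toEx] at h'
    exact .cons (Sig.toEx_eq_some ho) h' (by rwa [h.ops_eq]) h.toEx
end

end ImpEff

theorem theorem5p1 {Op : Type*} [DecidableEq Op] (Sg : ImpEff.Sig Op) (G : ImpEff.Env Op) :
    (∀ (v : ImpEff.Val Op) (A : ImpEff.VTy Op) (v' : ExEff.Val Op),
      ImpEff.ElabVal Sg G v A v' → ExEff.ValTy Sg.toEx G.toEx v' A.toEx) ∧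
    (∀ (c : ImpEff.Comp Op) (C : ImpEff.CTy Op) (c' : ExEff.Comp Op),
      ImpEff.ElabComp Sg G c C c' → ExEff.CompTy Sg.toEx G.toEx c' C.toEx) :=
  ⟨fun _ _ _ h => h.toEx, fun _ _ _ h => h.toEx⟩
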